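/- **Setting.** Let $\gamma$ be a full-rank density operator (the thermal state) on a finite-dimensional Hilbert space of dimension $d$, with smallest and largest eigenvalues (populations in the energy eigenbasis) $g_{\min}$ and $g_{\max}$. Systems $A$ and $B$ both have this Hilbert space and the thermal state $\gamma_A=\gamma_B=\gamma$; the control qubit $C$ and its copy $C'$ have the thermal state $\gamma_C=\mathbb 1/2$, and the composite $BC'$ has the thermal state $\gamma_B\otimes\gamma_C$. For states, $\rho\le\sigma$ means that $\sigma-\rho$ is positive semidefinite; for linear maps, $\Phi\le\Psi$ means that $\Psi-\Phi$ is completely positive. For a state $\rho$ of a system $X$ with thermal state $\gamma_X$ and a channel $\Lambda$ (completely positive, trace preserving) from $X$ to $Y$ put $$R_{\mathrm T}(\rho)=\min\{r:\rho\le(1+r)\gamma_X\},\qquad R(\Lambda\|\Gamma)=\min\{r:\Lambda\le(1+r)\Gamma\},\quad \Gamma(\cdot)=\mathrm{Tr}\{\cdot\}\,\gamma_Y,$$ $$R_{\mathrm T}(\Lambda)=\min\{r:\Lambda\le(1+r)F,\ F\text{ a channel with }F(\gamma_X)=\gamma_Y\},$$ $$R_{\mathrm S}(\Lambda)=\min\{r:\Lambda\le(1+r)\Phi,\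 \Phi(\cdot)=\mathrm{Tr}\{\cdot\}\,\sigma\text{ for some state }\sigma\text{ of }Y\},$$ and, for a Gibbs-preserving channel $F$ (that is, $F(\gamma_X)=\gamma_Y$), $P_{\mathrm T}(F)=R(F\|\Gamma)$. Let $\alpha,s\in[0,1]$, $\varphi\in[0,2\pi]$, $\rho_C=|\psi\rangle\langle\psi|$ with $|\psi\rangle=\sqrt{\alpha}\,|0\rangle+e^{i\varphi}\sqrt{1-\alpha}\,|1\rangle$, and $G=s\Gamma+(1-s)\mathcal I$, where $\mathcal I$ is the identity channel. Let $(K_n)_n$ be any finite Kraus representation of $G$, let $S_{mn}=|0\rangle\langle 0|\otimes K_nK_m+|1\rangle\langle 1|\otimes K_mK_n$ be the Kraus operators of the quantum switch $\mathcal S[G,G]$, and let $\Lambda_{\mathcal S}(\cdot)=\mathcal S[G,G](\rho_C\otimes\cdot)=\sum_{m,n}S_{mn}(\rho_C\otimes\cdot)S_{mn}^\dagger$ be the induced channel from $A$ to $BC'$. **Theorem.** All minima defining $R(\Lambda_{\mathcal S}\|\Gamma)$, $R_{\mathrm T}(\Lambda_{\mathcal S})$, $R_{\mathrm S}(\Lambda_{\mathcal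 S})$, $R_{\mathrm T}(\rho_C)$, $P_{\mathrm T}(G)$ and $P_{\mathrm T}(\mathcal I)$ are attained, $P_{\mathrm T}(\mathcal I)>0$ if $d\ge 2$, and $$R(\Lambda_{\mathcal S}\|\Gamma)\le R_{\mathrm T}(\rho_C)+\frac{2P_{\mathrm T}(G)^2}{P_{\mathrm T}(\mathcal I)},\qquad R_{\mathrm T}(\rho_C)=1,$$ $$R(\Lambda_{\mathcal S}\|\Gamma)\ge R_{\mathrm S}(\Lambda_{\mathcal S})\ge \frac{g_{\min}^4}{2}\,\bigl[R(\Lambda_{\mathcal S}\|\Gamma)-R_{\mathrm T}(\Lambda_{\mathcal S})\bigr]^2,$$ $$R_{\mathrm T}(\Lambda_{\mathcal S})=\sqrt{1-4(1-g_{\max}^2)\bigl[2-(1-g_{\max}^2)s^2\bigr]s^2\alpha(1-\alpha)}.$$ The first inequality is an equality if $\alpha\in\{0,1\}$ or $s\in\{0,1\}$. (If $d=1$, then $P_{\mathrm T}(G)=P_{\mathrm T}(\mathcal I)=0$ and the quotient is read as $0$.) -/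

import Mathlib

open scoped Kronecker ComplexOrder

noncomputable section

namespace QSwitch

/-! Operators on a finite-dimensional system are complex matrices indexed by a finite type `n`;
a composite system is indexed by the product of the index types. -/

/-- Density operators: positive semidefinite with unit trace. -/
def IsState {n : Type*} [Fintype n] (ρ : Matrix n n ℂ) : Prop :=
  ρ.PosSemidef ∧ ρ.trace = 1

/-- The map `id_k ⊗ Φ`, acting blockwise on a `k × k` block matrix. -/
def ampliation {n m : Type*} (k : ℕ) (Φ : Matrix n n ℂ →ₗ[ℂ] Matrix m m ℂ)
    (M : Matrix (Fin k × n) (Fin k × n) ℂ) : Matrix (Fin k × m) (Fin k × m) ℂ :=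
  Matrix.of fun p q => Φ (Matrix.of fun i j => M (p.1, i) (q.1, j)) p.2 q.2

/-- Complete positivity: `id_k ⊗ Φ` maps positive semidefinite matrices to positive semidefinite
matrices, for every `k`. -/
def IsCP {n m : Type*} (Φ : Matrix n n ℂ →ₗ[ℂ] Matrix m m ℂ) : Prop :=
  ∀ (k : ℕ) (M : Matrix (Fin k × n) (Fin k × n) ℂ), M.PosSemidef → (ampliation k Φ M).PosSemidef

/-- Quantum channels: completely positive trace-preserving maps. -/
def IsChannel {n m : Type*} [Fintype n] [Fintype m]
    (Φ : Matrix n n ℂ →ₗ[ℂ] Matrix m m ℂ) : Prop :=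
  IsCP Φ ∧ ∀ X, (Φ X).trace = X.trace

/-- The trace-and-replace map `X ↦ Tr(X) σ`. -/
def replaceMap (n : Type*) [Fintype n] {m : Type*} (σ : Matrix m m ℂ) :
    Matrix n n ℂ →ₗ[ℂ] Matrix m m ℂ :=
  (Matrix.traceLinearMap n ℂ ℂ).smulRight σ

/-- Gibbs-preserving operations from a system with thermal state `γA` to one with thermal
state `γB`. -/
def IsGPO {n m : Type*} [Fintype n] [Fintype m] (γA : Matrix n n ℂ) (γB : Matrix m m ℂ)
    (G : Matrix n n ℂ →ₗ[ℂ] Matrix m m ℂ) : Prop :=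
  IsChannel G ∧ G γA = γB

/-- Non-signalling operations: trace-and-replace channels. -/
def IsNSO {n m : Type*} [Fintype n] [Fintype m]
    (Φ : Matrix n n ℂ →ₗ[ℂ] Matrix m m ℂ) : Prop :=
  ∃ σ : Matrix m m ℂ, IsState σ ∧ Φ = replaceMap n σ

/-- The order on states, `ρ ≤ σ` when `σ - ρ` is positive semidefinite. -/
def OpLE {n : Type*} (ρ σ : Matrix n n ℂ) : Prop := (σ - ρ).PosSemidef

/-- The order on linear maps, `Φ ≤ Ψ` when `Ψ - Φ` is completely positive. -/
def MapLE {n m : Type*} (Φ Ψ : Matrix n n ℂ →ₗ[ℂ] Matrix m m ℂ) : Prop := IsCP (Ψ - Φ)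

/-- The values `r` with `ρ ≤ (1 + r) γ`. -/
def stateAthermalitySet {n : Type*} (γ ρ : Matrix n n ℂ) : Set ℝ :=
  {r | OpLE ρ ((1 + r) • γ)}

/-- Robustness of athermality of a state, `R_T(ρ)`. -/
def stateAthermality {n : Type*} (γ ρ : Matrix n n ℂ) : ℝ := sInf (stateAthermalitySet γ ρ)

/-- The values `r` with `Λ ≤ (1 + r) G` for some Gibbs-preserving `G`. -/
def athermalitySet {n m : Type*} [Fintype n] [Fintype m] (γA : Matrix n n ℂ) (γB : Matrix m m ℂ)
    (Λ : Matrix n n ℂ →ₗ[ℂ] Matrix m m ℂ) : Set ℝ :=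
  {r | ∃ G, IsGPO γA γB G ∧ MapLE Λ ((1 + r) • G)}

/-- Robustness of athermality of a channel, `R_T(Λ)`. -/
def athermality {n m : Type*} [Fintype n] [Fintype m] (γA : Matrix n n ℂ) (γB : Matrix m m ℂ)
    (Λ : Matrix n n ℂ →ₗ[ℂ] Matrix m m ℂ) : ℝ := sInf (athermalitySet γA γB Λ)

/-- The values `r` with `Λ ≤ (1 + r) Φ` for some non-signalling `Φ`. -/
def signallingSet {n m : Type*} [Fintype n] [Fintype m]
    (Λ : Matrix n n ℂ →ₗ[ℂ] Matrix m m ℂ) : Set ℝ :=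
  {r | ∃ Φ, IsNSO Φ ∧ MapLE Λ ((1 + r) • Φ)}

/-- Robustness of signalling, `R_S(Λ)`. -/
def signalling {n m : Type*} [Fintype n] [Fintype m]
    (Λ : Matrix n n ℂ →ₗ[ℂ] Matrix m m ℂ) : ℝ := sInf (signallingSet Λ)

/-- The values `r` with `Λ ≤ (1 + r) Γ`, where `Γ X = Tr(X) γB` is the completely thermalising
channel. -/
def jointSet {n m : Type*} [Fintype n] (γB : Matrix m m ℂ)
    (Λ : Matrix n n ℂ →ₗ[ℂ] Matrix m m ℂ) : Set ℝ :=
  {r | MapLE Λ ((1 + r) • replaceMap n γB)}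

/-- The joint robustness `R(Λ‖Γ)`. For a Gibbs-preserving `Λ` it is the athermality
preservability `P_T(Λ)`. -/
def joint {n m : Type*} [Fintype n] (γB : Matrix m m ℂ)
    (Λ : Matrix n n ℂ →ₗ[ℂ] Matrix m m ℂ) : ℝ := sInf (jointSet γB Λ)

/-- The family `K` is a Kraus representation of `Ω`. -/
def IsKraus {n ι : Type*} [Fintype n] [Fintype ι] (K : ι → Matrix n n ℂ)
    (Ω : Matrix n n ℂ →ₗ[ℂ] Matrix n n ℂ) : Prop :=
  ∀ X, Ω X = ∑ i, K i * X * (K i).conjTranspose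

/-- `S_{ij} = |0⟩⟨0| ⊗ K_j K_i + |1⟩⟨1| ⊗ K_i K_j`, the Kraus operators of the quantum switch;
the control qubit is the first tensor factor. -/
def switchKraus {n ι : Type*} [Fintype n] (K : ι → Matrix n n ℂ) (i j : ι) :
    Matrix (Fin 2 × n) (Fin 2 × n) ℂ :=
  Matrix.single 0 0 1 ⊗ₖ (K j * K i) + Matrix.single 1 1 1 ⊗ₖ (K i * K j)

/-- The induced channel `X ↦ S[Ω, Ω](ρC ⊗ X)`, where `K` is a Kraus representation of `Ω`. -/
def inducedChannel {n ι : Type*} [Fintype n] [Fintype ι] (K : ι → Matrix n n ℂ)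
    (ρC : Matrix (Fin 2) (Fin 2) ℂ) :
    Matrix n n ℂ →ₗ[ℂ] Matrix (Fin 2 × n) (Fin 2 × n) ℂ where
  toFun X := ∑ i, ∑ j, switchKraus K i j * (ρC ⊗ₖ X) * (switchKraus K i j).conjTranspose
  map_add' X Y := by
    simp only [Matrix.kronecker_add, mul_add, add_mul, Finset.sum_add_distrib]
  map_smul' c X := by
    simp only [Matrix.kronecker_smul, mul_smul_comm, smul_mul_assoc, Finset.smul_sum,
      RingHom.id_apply]

/-- The control vector `√α |0⟩ + e^{iφ} √(1 - α) |1⟩`. -/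
def controlKet (α φ : ℝ) : Fin 2 → ℂ :=
  ![(Real.sqrt α : ℂ), Complex.exp (Complex.I * φ) * (Real.sqrt (1 - α) : ℂ)]

/-- The control state `ρ_C = |ψ⟩⟨ψ|`. -/
def controlState (α φ : ℝ) : Matrix (Fin 2) (Fin 2) ℂ :=
  Matrix.vecMulVec (controlKet α φ) (star (controlKet α φ))

/-- The thermal state `γ_C = 𝟙/2` of the control qubit. -/
def controlThermal : Matrix (Fin 2) (Fin 2) ℂ := (1 / 2 : ℂ) • 1

/-- The channel `s Γ + (1 - s) id`. -/
def partialThermal {n : Type*} [Fintype n] (γ : Matrix n n ℂ) (s : ℝ) :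
    Matrix n n ℂ →ₗ[ℂ] Matrix n n ℂ :=
  s • replaceMap n γ + (1 - s) • LinearMap.id

end QSwitch

end

/-!
Write `Γ = Tr(·) γ`, `t = (1 - s)²` and `q = Tr γ⁻¹ = ∑ᵢ 1 / gᵢ`. Whatever the Kraus representation,
the induced channel is the two-by-two block map with diagonal blocks `ρ₀₀ G²` and `ρ₁₁ G²`, where
`G² = (1 - t) Γ + t id`, and off-diagonal blocks `ρ₀₁ E` and `ρ₁₀ E`, where `E X = 2 s (1 - s) Tr(X)
γ + t X + s² γ X γ` (`inducedChannel_apply`, `crossTerm_partialThermal`).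

*Joint robustness.* A Schur complement of the Choi matrix shows that `a id ≤ c Γ` exactly when `a q
≤ c` (`isCP_smul_replaceMap_sub_smul_id_iff`), so `P_T(id) = q - 1` and `P_T(G) = (1 - s) (q - 1)`.
Since `ρ_C ≤ 𝟙` and the switch with control operator `𝟙` is `𝟙 ⊗ G²`, the joint robustness is at
most `1 + 2 t (q - 1)`, which is the asserted upper bound (`mem_jointSet_inducedChannel`).
Contracting the control with `|ψ⟩` gives the matching lower bound in the extreme cases
(`le_of_mem_jointSet_inducedChannel`).

*Athermality.* A channel is dominated by `(1 + r)` times a Gibbs-preserving one exactly when its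
output on the thermal state is dominated by `(1 + r)` times the thermal state
(`mem_athermalitySet_iff`). For the switch that output splits, in the eigenbasis of `γ`, into
two-by-two blocks of the control, whose positivity is read off from trace and determinant; the
largest population decides (`mem_athermalitySet_inducedChannel_iff`).

*Signalling.* If `Λ ≤ (1 + r) Tr(·) σ`, then `(1 + r) σ` and `Λ(γ)` differ by a positive matrix of
trace `r`, so `σ` is thermal up to `2 r / g_min` and `R(Λ‖Γ) ≤ R_T(Λ) + 2 R_S(Λ) / g_min`
(`mem_jointSet_of_signalling_of_athermality`). Multiplied by `R(Λ‖Γ) ≤ 2 q ≤ 2 / g_min²`, this gives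
the quadratic bound when the dimension is at least two, where `g_min ≤ 1 / 2`; in dimension one
`R(Λ‖Γ)` and `R_T(Λ)` are both `1`.

Attainment follows from closedness of the positive cone and, for the signalling robustness, from
compactness of the set of states.
-/

noncomputable section

namespace QSwitch

open Matrix

variable {n m k : Type*}

/-! ### Completely positive maps and Choi matrices -/

section CP

theorem ampliation_add (d : ℕ) (Φ Ψ : Matrix n n ℂ →ₗ[ℂ] Matrix m m ℂ)
    (M : Matrix (Fin d × n) (Fin d × n) ℂ) :
    ampliation d (Φ + Ψ) M = ampliation d Φ M + ampliation d Ψ M := rfl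

theorem ampliation_smul (d : ℕ) (c : ℝ) (Φ : Matrix n n ℂ →ₗ[ℂ] Matrix m m ℂ)
    (M : Matrix (Fin d × n) (Fin d × n) ℂ) :
    ampliation d (c • Φ) M = c • ampliation d Φ M := rfl

theorem IsCP.add {Φ Ψ : Matrix n n ℂ →ₗ[ℂ] Matrix m m ℂ} (hΦ : IsCP Φ) (hΨ : IsCP Ψ) :
    IsCP (Φ + Ψ) := fun d M hM => by
  rw [ampliation_add]
  exact (hΦ d M hM).add (hΨ d M hM)

theorem posSemidef_real_smul {A : Matrix n n ℂ} (hA : A.PosSemidef) {c : ℝ} (hc : 0 ≤ c) :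
    (c • A).PosSemidef := hA.smul hc

theorem IsCP.smul {Φ : Matrix n n ℂ →ₗ[ℂ] Matrix m m ℂ} (hΦ : IsCP Φ) {c : ℝ} (hc : 0 ≤ c) :
    IsCP (c • Φ) := fun d M hM => by
  rw [ampliation_smul]
  exact posSemidef_real_smul (hΦ d M hM) hc

theorem isCP_zero : IsCP (0 : Matrix n n ℂ →ₗ[ℂ] Matrix m m ℂ) := fun _ _ _ =>
  Matrix.PosSemidef.zero

theorem IsCP.sum {ι : Type*} (S : Finset ι) {Φ : ι → Matrix n n ℂ →ₗ[ℂ] Matrix m m ℂ}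
    (h : ∀ i ∈ S, IsCP (Φ i)) : IsCP (∑ i ∈ S, Φ i) := by
  classical
  induction S using Finset.induction_on with
  | empty => simpa using isCP_zero
  | insert i S hi ih =>
    rw [Finset.sum_insert hi]
    exact (h i (by simp)).add (ih fun j hj => h j (by simp [hj]))

theorem IsCP.comp {Φ : Matrix n n ℂ →ₗ[ℂ] Matrix m m ℂ} {Ψ : Matrix m m ℂ →ₗ[ℂ] Matrix k k ℂ}
    (hΨ : IsCP Ψ) (hΦ : IsCP Φ) : IsCP (Ψ ∘ₗ Φ) := fun d M hM => hΨ d _ (hΦ d M hM)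

theorem IsCP.posSemidef_apply {Φ : Matrix n n ℂ →ₗ[ℂ] Matrix m m ℂ} (hΦ : IsCP Φ)
    {X : Matrix n n ℂ} (hX : X.PosSemidef) : (Φ X).PosSemidef := by
  exact (hΦ 1 (X.submatrix Prod.snd Prod.snd) (hX.submatrix _)).submatrix (fun i => (0, i))

/-- The map `X ↦ V X V†`. -/
def conjBy [Fintype n] (V : Matrix m n ℂ) : Matrix n n ℂ →ₗ[ℂ] Matrix m m ℂ where
  toFun X := V * X * Vᴴ
  map_add' X Y := by simp only [Matrix.mul_add, Matrix.add_mul]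
  map_smul' c X := by simp

@[simp]
theorem conjBy_apply [Fintype n] (V : Matrix m n ℂ) (X : Matrix n n ℂ) :
    conjBy V X = V * X * Vᴴ := rfl

theorem isCP_conjBy [Fintype n] [Finite m] (V : Matrix m n ℂ) : IsCP (conjBy V) := by
  intro d M hM
  have : ampliation d (conjBy V) M
      = ((1 : Matrix (Fin d) (Fin d) ℂ) ⊗ₖ V) * M * ((1 : Matrix (Fin d) (Fin d) ℂ) ⊗ₖ V)ᴴ := by
    ext ⟨x, i⟩ ⟨y, j⟩
    simp [ampliation, Matrix.mul_apply, Fintype.sum_prod_type, Matrix.one_apply, Finset.sum_mul,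
      apply_ite]
  rw [this]
  exact hM.mul_mul_conjTranspose_same _

/-- Appending an ancilla, `X ↦ P ⊗ X`. -/
def tensorLeft (P : Matrix k k ℂ) : Matrix n n ℂ →ₗ[ℂ] Matrix (k × n) (k × n) ℂ where
  toFun X := P ⊗ₖ X
  map_add' X Y := kronecker_add P X Y
  map_smul' c X := kronecker_smul c P X

@[simp]
theorem tensorLeft_apply (P : Matrix k k ℂ) (X : Matrix n n ℂ) : tensorLeft P X = P ⊗ₖ X := rfl

theorem isCP_tensorLeft [Finite k] [Finite n] {P : Matrix k k ℂ} (hP : P.PosSemidef) :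
    IsCP (tensorLeft (n := n) P) := fun d M hM => by
  have := Fintype.ofFinite k
  have := Fintype.ofFinite n
  exact (hP.kronecker hM).submatrix
    (fun p : Fin d × (k × n) => (p.2.1, (p.1, p.2.2)))

/-- The Choi matrix of a linear map, with the input system as the first tensor factor. -/
def choi [DecidableEq n] (Φ : Matrix n n ℂ →ₗ[ℂ] Matrix m m ℂ) : Matrix (n × m) (n × m) ℂ :=
  Matrix.of fun p q => Φ (Matrix.single p.1 q.1 1) p.2 q.2

theorem apply_eq_sum_choi [Fintype n] [DecidableEq n] (Φ : Matrix n n ℂ →ₗ[ℂ] Matrix m m ℂ)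
    (X : Matrix n n ℂ) (i j : m) :
    Φ X i j = ∑ a, ∑ b, X a b * choi Φ (a, i) (b, j) := by
  conv_lhs => rw [Matrix.matrix_eq_sum_single X]
  simp only [map_sum, Matrix.sum_apply]
  refine Finset.sum_congr rfl fun a _ => Finset.sum_congr rfl fun b _ => ?_
  have : Matrix.single a b (X a b) = X a b • Matrix.single a b (1 : ℂ) := by
    simp [Matrix.smul_single]
  rw [this, map_smul]
  rfl

open scoped MatrixOrder in
/-- Choi's theorem. The converse direction is proved by reading off Kraus operators from a
factorisation `B† B` of the Choi matrix. -/
theorem isCP_iff_posSemidef_choi [Fintype n] [DecidableEq n] [Finite m]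
    {Φ : Matrix n n ℂ →ₗ[ℂ] Matrix m m ℂ} : IsCP Φ ↔ (choi Φ).PosSemidef := by
  have := Fintype.ofFinite m
  classical
  constructor
  · intro h
    let e := Fintype.equivFin n
    let ω : Fin (Fintype.card n) × n → ℂ := fun p => if e.symm p.1 = p.2 then 1 else 0
    have h1 := (h _ _ (Matrix.posSemidef_vecMulVec_self_star ω)).submatrix
      (fun p : n × m => (e p.1, p.2))
    convert h1 using 1
    ext ⟨a, i⟩ ⟨b, j⟩
    simp only [choi, ampliation, Matrix.of_apply, Matrix.submatrix_apply]
    refine congrFun (congrFun (congrArg Φ ?_) i) j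
    ext x y
    simp only [ω, Matrix.single_apply, Matrix.of_apply, Matrix.vecMulVec_apply, Pi.star_apply,
      Equiv.symm_apply_apply]
    by_cases h1 : a = x <;> by_cases h2 : b = y <;> simp [h1, h2]
  · intro h
    obtain ⟨B, hB⟩ := CStarAlgebra.nonneg_iff_eq_star_mul_self.mp
      (Matrix.nonneg_iff_posSemidef.mpr h)
    have key : Φ = ∑ l, conjBy (Matrix.of fun (i : m) (a : n) => star (B l (a, i))) := by
      refine LinearMap.ext fun X => ?_
      ext i j
      rw [apply_eq_sum_choi, hB]
      simp only [LinearMap.sum_apply, Matrix.sum_apply, conjBy_apply, Matrix.mul_apply,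
        Matrix.star_apply, Matrix.of_apply, Matrix.conjTranspose_apply, star_star, Finset.mul_sum,
        Finset.sum_mul]
      rw [Finset.sum_comm]
      rw [Finset.sum_congr rfl fun b _ => Finset.sum_comm, Finset.sum_comm]
      refine Finset.sum_congr rfl fun l _ => Finset.sum_congr rfl fun b _ =>
        Finset.sum_congr rfl fun a _ => by ring
    rw [key]
    exact IsCP.sum _ fun l _ => isCP_conjBy _

theorem choi_replaceMap [Fintype n] [DecidableEq n] (σ : Matrix m m ℂ) :
    choi (replaceMap n σ) = (1 : Matrix n n ℂ) ⊗ₖ σ := by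
  ext ⟨a, i⟩ ⟨b, j⟩
  by_cases h : a = b
  · subst h
    simp [choi, replaceMap]
  · simp [choi, replaceMap, h, Matrix.trace_single_eq_of_ne]

theorem isCP_replaceMap [Fintype n] [Finite m] {σ : Matrix m m ℂ} (hσ : σ.PosSemidef) :
    IsCP (replaceMap n σ) := by
  classical
  have := Fintype.ofFinite m
  rw [isCP_iff_posSemidef_choi, choi_replaceMap]
  exact Matrix.PosSemidef.one.kronecker hσ

theorem replaceMap_apply [Fintype n] (σ : Matrix m m ℂ) (X : Matrix n n ℂ) :
    replaceMap n σ X = X.trace • σ := rfl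

/-- The unnormalised maximally entangled vector `∑ₐ |a⟩|a⟩`. -/
def maxEnt (n : Type*) [DecidableEq n] : n × n → ℂ := fun p => if p.1 = p.2 then 1 else 0

theorem choi_id [DecidableEq n] : choi (LinearMap.id : Matrix n n ℂ →ₗ[ℂ] Matrix n n ℂ)
    = vecMulVec (maxEnt n) (star (maxEnt n)) := by
  ext ⟨a, i⟩ ⟨b, j⟩
  by_cases h1 : a = i <;> by_cases h2 : b = j <;>
    simp [choi, maxEnt, Matrix.single_apply, vecMulVec_apply, h1, h2]

/-- A positive definite matrix dominates the rank-one matrix `v v†` exactly when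
`⟨v, A⁻¹ v⟩ ≤ 1`: both are Schur complements of one block matrix. -/
theorem posSemidef_sub_vecMulVec_iff [Fintype n] [DecidableEq n] {A : Matrix n n ℂ}
    (hA : A.PosDef) (v : n → ℂ) :
    (A - vecMulVec v (star v)).PosSemidef ↔ star v ⬝ᵥ (A⁻¹ *ᵥ v) ≤ 1 := by
  have := hA.isUnit.invertible
  have : Invertible (1 : Matrix Unit Unit ℂ) := invertibleOne
  let B : Matrix n Unit ℂ := replicateCol Unit v
  have h1 := PosDef.fromBlocks₁₁ (A := A) B (1 : Matrix Unit Unit ℂ) hA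
  have h2 := PosDef.fromBlocks₂₂ A B (D := (1 : Matrix Unit Unit ℂ)) PosDef.one
  rw [h1] at h2
  have e1 : A - B * (1 : Matrix Unit Unit ℂ)⁻¹ * Bᴴ = A - vecMulVec v (star v) := by
    ext i j
    simp [B, Matrix.mul_apply, vecMulVec_apply]
  rw [e1] at h2
  rw [← h2]
  have e2 : (1 : Matrix Unit Unit ℂ) - Bᴴ * A⁻¹ * B
      = diagonal fun _ => 1 - star v ⬝ᵥ (A⁻¹ *ᵥ v) := by
    ext i j
    rw [Matrix.mul_assoc]
    simp [B, Matrix.mul_apply, dotProduct, mulVec]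
  rw [e2, posSemidef_diagonal_iff]
  simp

end CP

/-! ### Spectral bounds -/

section Spectral

variable [Fintype n] [DecidableEq n] {A : Matrix n n ℂ}

/-- Unitary diagonalisation, in terms of plain matrix products. -/
theorem exists_unitary_diagonalization (hA : A.IsHermitian) :
    ∃ U : Matrix n n ℂ, U * Uᴴ = 1 ∧ Uᴴ * U = 1 ∧
      A = U * diagonal (fun i => (hA.eigenvalues i : ℂ)) * Uᴴ := by
  refine ⟨hA.eigenvectorUnitary, ?_, ?_, ?_⟩
  · exact Unitary.coe_mul_star_self _
  · exact Unitary.coe_star_mul_self _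
  · exact hA.spectral_theorem

theorem posSemidef_sub_smul_one (hA : A.IsHermitian) {c : ℝ} (h : ∀ i, c ≤ hA.eigenvalues i) :
    (A - c • (1 : Matrix n n ℂ)).PosSemidef := by
  obtain ⟨U, hU, -, hA'⟩ := exists_unitary_diagonalization hA
  have : A - c • (1 : Matrix n n ℂ)
      = U * diagonal (fun i => ((hA.eigenvalues i - c : ℝ) : ℂ)) * Uᴴ := by
    have e : diagonal (fun i => ((hA.eigenvalues i - c : ℝ) : ℂ))
        = diagonal (fun i => (hA.eigenvalues i : ℂ)) - c • (1 : Matrix n n ℂ) := by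
      ext i j
      by_cases hij : i = j <;> simp [hij]
    rw [e, Matrix.mul_sub, Matrix.sub_mul, ← hA']
    simp [hU]
  rw [this]
  refine PosSemidef.mul_mul_conjTranspose_same (posSemidef_diagonal_iff.mpr fun i => ?_) _
  exact_mod_cast sub_nonneg.mpr (h i)

theorem trace_re_eq_sum_eigenvalues (hA : A.IsHermitian) :
    A.trace = ((∑ i, hA.eigenvalues i : ℝ) : ℂ) := by
  rw [hA.trace_eq_sum_eigenvalues]
  push_cast
  rfl

/-- A positive semidefinite matrix is dominated by its trace. -/
theorem posSemidef_smul_one_sub (hA : A.PosSemidef) {c : ℝ} (hc : A.trace = c) :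
    (c • (1 : Matrix n n ℂ) - A).PosSemidef := by
  obtain ⟨U, hU, -, hA'⟩ := exists_unitary_diagonalization hA.1
  have : c • (1 : Matrix n n ℂ) - A
      = U * diagonal (fun i => ((c - hA.1.eigenvalues i : ℝ) : ℂ)) * Uᴴ := by
    have e : diagonal (fun i => ((c - hA.1.eigenvalues i : ℝ) : ℂ))
        = c • (1 : Matrix n n ℂ) - diagonal (fun i => (hA.1.eigenvalues i : ℂ)) := by
      ext i j
      by_cases hij : i = j <;> simp [hij]
    rw [e, Matrix.mul_sub, Matrix.sub_mul, ← hA']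
    simp [hU]
  rw [this]
  refine PosSemidef.mul_mul_conjTranspose_same (posSemidef_diagonal_iff.mpr fun i => ?_) _
  have h1 : hA.1.eigenvalues i ≤ c := by
    rw [trace_re_eq_sum_eigenvalues hA.1] at hc
    rw [← Complex.ofReal_inj.mp hc]
    exact Finset.single_le_sum (fun j _ => hA.eigenvalues_nonneg j) (Finset.mem_univ i)
  exact_mod_cast sub_nonneg.mpr h1

theorem trace_inv_eq_sum (hA : A.PosDef) :
    A⁻¹.trace = ((∑ i, (hA.isHermitian.eigenvalues i)⁻¹ : ℝ) : ℂ) := by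
  obtain ⟨U, hU, hU', hA'⟩ := exists_unitary_diagonalization hA.isHermitian
  have hinv : A⁻¹ = U * diagonal (fun i => ((hA.isHermitian.eigenvalues i)⁻¹ : ℂ)) * Uᴴ := by
    refine Matrix.inv_eq_right_inv ?_
    rw [← hU]
    refine (congrArg (· * _) hA').trans ?_
    have e : diagonal (fun i => (hA.isHermitian.eigenvalues i : ℂ)) *
        diagonal (fun i => ((hA.isHermitian.eigenvalues i)⁻¹ : ℂ)) = 1 := by
      rw [diagonal_mul_diagonal, ← diagonal_one]
      congr 1
      ext i
      exact mul_inv_cancel₀ (by exact_mod_cast (hA.eigenvalues_pos i).ne')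
    calc _ = U * diagonal (fun i => (hA.isHermitian.eigenvalues i : ℂ)) * (Uᴴ * U) *
          diagonal (fun i => ((hA.isHermitian.eigenvalues i)⁻¹ : ℂ)) * Uᴴ := by
            simp only [Matrix.mul_assoc]
      _ = U * (diagonal (fun i => (hA.isHermitian.eigenvalues i : ℂ)) *
          diagonal (fun i => ((hA.isHermitian.eigenvalues i)⁻¹ : ℂ))) * Uᴴ := by
            rw [hU', Matrix.mul_one, Matrix.mul_assoc U]
      _ = _ := by rw [e, Matrix.mul_one]
  rw [hinv, Matrix.trace_mul_comm, ← Matrix.mul_assoc, hU', Matrix.one_mul, trace_diagonal]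
  push_cast
  rfl

end Spectral

/-! ### Order relations and traces -/

section Positivity

theorem eigenvalues_sum_eq_one [Fintype n] [DecidableEq n] {γ : Matrix n n ℂ} (hγ : γ.PosDef)
    (hγ_tr : γ.trace = 1) : ∑ i, hγ.isHermitian.eigenvalues i = 1 := by
  have := trace_re_eq_sum_eigenvalues hγ.isHermitian
  rw [hγ_tr] at this
  exact_mod_cast this.symm

theorem nonempty_of_trace_eq_one [Fintype n] {γ : Matrix n n ℂ} (hγ_tr : γ.trace = 1) :
    Nonempty n := by
  by_contra h
  rw [not_nonempty_iff] at h
  simp [Matrix.trace] at hγ_tr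

theorem OpLE.nonneg_of_trace [Fintype n] {ρ σ : Matrix n n ℂ} {r : ℝ} (h : OpLE ρ ((1 + r) • σ))
    (hρ : ρ.trace = 1) (hσ : σ.trace = 1) : 0 ≤ r := by
  have := PosSemidef.trace_nonneg h
  rw [trace_sub, trace_smul, hρ, hσ] at this
  have h2 : ((1 + r : ℝ) : ℂ) - 1 = (r : ℂ) := by push_cast; ring
  rw [Complex.real_smul, mul_one, h2] at this
  exact_mod_cast this

theorem MapLE.opLE_apply {Φ Ψ : Matrix n n ℂ →ₗ[ℂ] Matrix m m ℂ} (h : MapLE Φ Ψ)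
    {X : Matrix n n ℂ} (hX : X.PosSemidef) : OpLE (Φ X) (Ψ X) :=
  IsCP.posSemidef_apply h hX

theorem MapLE.trans {Φ Ψ Ω : Matrix n n ℂ →ₗ[ℂ] Matrix m m ℂ} (h : MapLE Φ Ψ) (h' : MapLE Ψ Ω) :
    MapLE Φ Ω := by
  have := IsCP.add h h'
  rwa [show Ψ - Φ + (Ω - Ψ) = Ω - Φ by abel] at this

theorem MapLE.nonneg_of_trace [Fintype n] [Fintype m] {Φ Ψ : Matrix n n ℂ →ₗ[ℂ] Matrix m m ℂ}
    {r : ℝ} (h : MapLE Φ ((1 + r) • Ψ)) {X : Matrix n n ℂ} (hX : IsState X)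
    (hΦ : (Φ X).trace = 1) (hΨ : (Ψ X).trace = 1) : 0 ≤ r :=
  OpLE.nonneg_of_trace (h.opLE_apply hX.1) hΦ hΨ

theorem replaceMap_smul [Fintype n] (c : ℝ) (σ : Matrix m m ℂ) :
    replaceMap n (c • σ) = c • replaceMap n σ :=
  LinearMap.ext fun X => smul_comm X.trace c σ

theorem replaceMap_sub [Fintype n] (σ τ : Matrix m m ℂ) :
    replaceMap n (σ - τ) = replaceMap n σ - replaceMap n τ :=
  LinearMap.ext fun X => smul_sub X.trace σ τ

theorem mapLE_replaceMap [Fintype n] [Finite m] {σ τ : Matrix m m ℂ} (h : OpLE σ τ) :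
    MapLE (replaceMap n σ) (replaceMap n τ) := by
  have := isCP_replaceMap (n := n) h
  rwa [replaceMap_sub] at this

theorem isChannel_replaceMap [Fintype n] [Fintype m] {σ : Matrix m m ℂ} (hσ : IsState σ) :
    IsChannel (replaceMap n σ) :=
  ⟨isCP_replaceMap hσ.1, fun X => by rw [replaceMap_apply, trace_smul, hσ.2, smul_eq_mul, mul_one]⟩

end Positivity

/-! ### Robustness of the identity and of the partially thermalising channel -/

section Thermal

variable [Fintype n] [DecidableEq n] {γ : Matrix n n ℂ}

theorem maxEnt_dotProduct_inv (γ : Matrix n n ℂ) :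
    star (maxEnt n) ⬝ᵥ (((1 : Matrix n n ℂ) ⊗ₖ γ) *ᵥ maxEnt n) = γ.trace := by
  simp [dotProduct, mulVec, maxEnt, Fintype.sum_prod_type, Matrix.trace, Matrix.one_apply,
    apply_ite]

/-- The least multiple of `Γ` dominating `a • id` is `a Tr γ⁻¹`: the Choi matrices are `𝟙 ⊗ γ` and
the rank-one matrix of the unnormalised maximally entangled vector. -/
theorem isCP_smul_replaceMap_sub_smul_id_iff (hγ : γ.PosDef) (hγ_tr : γ.trace = 1) {q : ℝ}
    (hq : γ⁻¹.trace = q) {a t : ℝ} (ha : 0 ≤ a) :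
    IsCP (t • replaceMap n γ - a • (LinearMap.id : Matrix n n ℂ →ₗ[ℂ] Matrix n n ℂ)) ↔
      a * q ≤ t := by
  have hne := nonempty_of_trace_eq_one hγ_tr
  have hq0 : 0 < q := by
    have := hγ.inv.trace_pos
    rw [hq] at this
    exact_mod_cast this
  -- evaluating at the state `γ` and taking the trace
  have hat : IsCP (t • replaceMap n γ - a • (LinearMap.id : Matrix n n ℂ →ₗ[ℂ] Matrix n n ℂ)) →
      a ≤ t := fun h => by
    have := (h.posSemidef_apply hγ.posSemidef).trace_nonneg
    simp only [LinearMap.sub_apply, LinearMap.smul_apply, replaceMap_apply, hγ_tr, one_smul,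
      LinearMap.id_apply, trace_sub, trace_smul, Complex.real_smul, mul_one, sub_nonneg] at this
    exact_mod_cast this
  rcases ha.eq_or_lt with rfl | ha
  · rw [zero_mul]
    refine ⟨hat, fun h => ?_⟩
    rw [zero_smul, sub_zero]
    exact (isCP_replaceMap hγ.posSemidef).smul h
  by_cases ht : 0 < t
  swap
  · exact ⟨fun h => absurd (ha.trans_le (hat h)) ht,
      fun h => absurd ((mul_pos ha hq0).trans_le h) ht⟩
  have hpd : (t • ((1 : Matrix n n ℂ) ⊗ₖ γ)).PosDef := (PosDef.one.kronecker hγ).smul ht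
  have e : choi (t • replaceMap n γ - a • (LinearMap.id : Matrix n n ℂ →ₗ[ℂ] Matrix n n ℂ))
      = t • ((1 : Matrix n n ℂ) ⊗ₖ γ) -
        vecMulVec ((√a : ℂ) • maxEnt n) (star ((√a : ℂ) • maxEnt n)) := by
    have h1 : choi (t • replaceMap n γ - a • (LinearMap.id : Matrix n n ℂ →ₗ[ℂ] Matrix n n ℂ))
      = t • choi (replaceMap n γ) - a • choi LinearMap.id := rfl
    rw [h1, choi_replaceMap, choi_id, star_smul, smul_vecMulVec, vecMulVec_smul, smul_smul]
    congr 1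
    rw [← Complex.coe_smul]
    congr 1
    simp only [RCLike.star_def, Complex.conj_ofReal]
    exact_mod_cast (Real.mul_self_sqrt ha.le).symm
  rw [isCP_iff_posSemidef_choi, e, posSemidef_sub_vecMulVec_iff hpd]
  have hinv : (t • ((1 : Matrix n n ℂ) ⊗ₖ γ))⁻¹ = (t⁻¹ : ℂ) • ((1 : Matrix n n ℂ) ⊗ₖ γ⁻¹) := by
    refine Matrix.inv_eq_right_inv ?_
    rw [← Complex.coe_smul, smul_mul_smul_comm, ← mul_kronecker_mul,
      Matrix.mul_nonsing_inv _ hγ.det_pos.ne'.isUnit, mul_inv_cancel₀ (by exact_mod_cast ht.ne')]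
    simp
  rw [hinv, smul_mulVec, mulVec_smul, star_smul, smul_dotProduct, dotProduct_smul,
    dotProduct_smul, maxEnt_dotProduct_inv, hq]
  simp only [RCLike.star_def, Complex.conj_ofReal, smul_eq_mul]
  have e3 : (√a : ℂ) * ((t : ℂ)⁻¹ * ((√a : ℂ) * (q : ℂ))) = ((a * q / t : ℝ) : ℂ) := by
    have : (√a : ℂ) * (√a : ℂ) = (a : ℂ) := by exact_mod_cast Real.mul_self_sqrt ha.le
    push_cast
    rw [← this]
    ring
  rw [e3]
  rw [show (1 : ℂ) = ((1 : ℝ) : ℂ) by simp, Complex.real_le_real, div_le_one ht]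

theorem mem_jointSet_id_iff (hγ : γ.PosDef) (hγ_tr : γ.trace = 1) {q : ℝ}
    (hq : γ⁻¹.trace = q) {r : ℝ} :
    r ∈ jointSet γ (LinearMap.id : Matrix n n ℂ →ₗ[ℂ] Matrix n n ℂ) ↔ q - 1 ≤ r := by
  have := isCP_smul_replaceMap_sub_smul_id_iff hγ hγ_tr hq (a := 1) (t := 1 + r) zero_le_one
  rw [one_smul, one_mul] at this
  rw [sub_le_iff_le_add']
  exact this

theorem mem_jointSet_partialThermal_iff (hγ : γ.PosDef) (hγ_tr : γ.trace = 1) {q : ℝ}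
    (hq : γ⁻¹.trace = q) {s : ℝ} (hs : s ≤ 1) {r : ℝ} :
    r ∈ jointSet γ (partialThermal γ s) ↔ (1 - s) * (q - 1) ≤ r := by
  have := isCP_smul_replaceMap_sub_smul_id_iff hγ hγ_tr hq (a := 1 - s) (t := 1 + r - s)
    (sub_nonneg.mpr hs)
  rw [show (1 - s) * (q - 1) ≤ r ↔ (1 - s) * q ≤ 1 + r - s by constructor <;> intro h <;> linarith,
    ← this]
  change IsCP _ ↔ _
  rw [partialThermal, ← sub_sub, sub_smul (1 + r) s (replaceMap n γ)]

theorem isLeast_of_forall_mem_iff {S : Set ℝ} {a : ℝ} (h : ∀ r, r ∈ S ↔ a ≤ r) : IsLeast S a :=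
  ⟨(h a).mpr le_rfl, fun r hr => (h r).mp hr⟩

end Thermal

/-! ### Attained minima and general bounds -/

section Attained

theorem isClosed_posSemidef [Finite n] : IsClosed {A : Matrix n n ℂ | A.PosSemidef} := by
  have := Fintype.ofFinite n
  simp only [posSemidef_iff_dotProduct_mulVec, Set.ofPred_and, Set.ofPred_forall]
  refine IsClosed.inter ?_ (isClosed_iInter fun x => ?_)
  · exact isClosed_eq (by fun_prop) continuous_id
  · exact isClosed_le continuous_const (by fun_prop)

open scoped MatrixOrder in
/-- The set of states is compact, being the image of a sphere under `B ↦ B† B`. -/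
theorem isCompact_states [Fintype n] : IsCompact {σ : Matrix n n ℂ | IsState σ} := by
  classical
  have himg : {σ : Matrix n n ℂ | IsState σ}
      = (fun B : Matrix n n ℂ => Bᴴ * B) '' {B | (Bᴴ * B).trace = 1} := by
    ext σ
    constructor
    · rintro ⟨h1, h2⟩
      obtain ⟨B, rfl⟩ := CStarAlgebra.nonneg_iff_eq_star_mul_self.mp h1.nonneg
      exact ⟨B, h2, rfl⟩
    · rintro ⟨B, hB, rfl⟩
      exact ⟨posSemidef_conjTranspose_mul_self B, hB⟩
  rw [himg]
  refine IsCompact.image ?_ (by fun_prop)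
  have hK : IsCompact {B : Matrix n n ℂ | ∀ i j, B i j ∈ Metric.closedBall (0 : ℂ) 1} :=
    isCompact_pi_infinite fun _ => isCompact_pi_infinite fun _ => isCompact_closedBall _ _
  refine hK.of_isClosed_subset (isClosed_eq (by fun_prop) continuous_const) fun B hB i j => ?_
  rw [mem_closedBall_zero_iff]
  have h1 : ∑ y, ∑ x, ‖B x y‖ ^ 2 = 1 := by
    have h2 : (Bᴴ * B).trace = ((∑ y, ∑ x, ‖B x y‖ ^ 2 : ℝ) : ℂ) := by
      simp only [Matrix.trace, diag_apply, Matrix.mul_apply, conjTranspose_apply]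
      push_cast
      refine Finset.sum_congr rfl fun y _ => Finset.sum_congr rfl fun x _ => ?_
      exact Complex.conj_mul' _
    rw [Set.mem_ofPred_eq, h2] at hB
    exact_mod_cast hB
  have h3 : ‖B i j‖ ^ 2 ≤ 1 := by
    rw [← h1]
    exact (Finset.single_le_sum (f := fun x => ‖B x j‖ ^ 2) (fun x _ => sq_nonneg _)
      (Finset.mem_univ i)).trans
      (Finset.single_le_sum (f := fun y => ∑ x, ‖B x y‖ ^ 2)
        (fun y _ => Finset.sum_nonneg fun x _ => sq_nonneg _) (Finset.mem_univ j))
  exact (sq_le_one_iff₀ (norm_nonneg _)).mp h3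

theorem mapLE_smul_replaceMap_iff [Fintype n] [DecidableEq n] [Finite m]
    {Λ : Matrix n n ℂ →ₗ[ℂ] Matrix m m ℂ} {σ : Matrix m m ℂ} {c : ℝ} :
    MapLE Λ (c • replaceMap n σ) ↔ (c • ((1 : Matrix n n ℂ) ⊗ₖ σ) - choi Λ).PosSemidef := by
  rw [← choi_replaceMap]
  exact isCP_iff_posSemidef_choi

theorem jointSet_bddBelow [Fintype n] [Fintype m] {γA : Matrix n n ℂ} {γB : Matrix m m ℂ}
    {Λ : Matrix n n ℂ →ₗ[ℂ] Matrix m m ℂ} (hA : IsState γA) (hB : γB.trace = 1)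
    (hΛ : ∀ X, (Λ X).trace = X.trace) {r : ℝ} (hr : r ∈ jointSet γB Λ) : 0 ≤ r :=
  MapLE.nonneg_of_trace hr hA ((hΛ _).trans hA.2)
    (by rw [replaceMap_apply, hA.2, one_smul, hB])

theorem signallingSet_bddBelow [Fintype n] [Fintype m] {γA : Matrix n n ℂ}
    {Λ : Matrix n n ℂ →ₗ[ℂ] Matrix m m ℂ} (hA : IsState γA)
    (hΛ : ∀ X, (Λ X).trace = X.trace) {r : ℝ} (hr : r ∈ signallingSet Λ) : 0 ≤ r := by
  obtain ⟨_, ⟨σ, hσ, rfl⟩, h⟩ := hr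
  exact jointSet_bddBelow hA hσ.2 hΛ h

theorem isLeast_joint [Fintype n] [Fintype m] {γA : Matrix n n ℂ} {γB : Matrix m m ℂ}
    {Λ : Matrix n n ℂ →ₗ[ℂ] Matrix m m ℂ} (hA : IsState γA) (hB : γB.trace = 1)
    (hΛ : ∀ X, (Λ X).trace = X.trace) (hne : (jointSet γB Λ).Nonempty) :
    IsLeast (jointSet γB Λ) (joint γB Λ) := by
  classical
  have hb : BddBelow (jointSet γB Λ) := ⟨0, fun r hr => jointSet_bddBelow hA hB hΛ hr⟩
  refine ⟨IsClosed.csInf_mem ?_ hne hb, fun r hr => csInf_le hb hr⟩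
  have : jointSet γB Λ = (fun r : ℝ => (1 + r) • ((1 : Matrix n n ℂ) ⊗ₖ γB) - choi Λ) ⁻¹'
      {A | A.PosSemidef} := Set.ext fun r => mapLE_smul_replaceMap_iff
  rw [this]
  exact isClosed_posSemidef.preimage (by fun_prop)

theorem isLeast_signalling [Fintype n] [Fintype m] {γA : Matrix n n ℂ}
    {Λ : Matrix n n ℂ →ₗ[ℂ] Matrix m m ℂ} (hA : IsState γA)
    (hΛ : ∀ X, (Λ X).trace = X.trace) (hne : (signallingSet Λ).Nonempty) :
    IsLeast (signallingSet Λ) (signalling Λ) := by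
  classical
  obtain ⟨R, hR⟩ := hne
  have hb : BddBelow (signallingSet Λ) := ⟨0, fun r hr => signallingSet_bddBelow hA hΛ hr⟩
  -- the admissible pairs `(r, σ)` with `r ≤ R` form a compact set
  let S : Set (ℝ × Matrix m m ℂ) := (Set.Icc 0 R ×ˢ {σ | IsState σ}) ∩
    {x | ((1 + x.1) • ((1 : Matrix n n ℂ) ⊗ₖ x.2) - choi Λ).PosSemidef}
  have hcont : Continuous fun x : ℝ × Matrix m m ℂ =>
      (1 + x.1) • ((1 : Matrix n n ℂ) ⊗ₖ x.2) - choi Λ := by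
    have : Continuous fun x : ℝ × Matrix m m ℂ => (1 : Matrix n n ℂ) ⊗ₖ x.2 :=
      continuous_matrix fun i j =>
        (continuous_const (y := (1 : Matrix n n ℂ) i.1 j.1)).mul
          (continuous_snd.matrix_elem i.2 j.2)
    fun_prop
  have hS : IsCompact S :=
    (isCompact_Icc.prod isCompact_states).inter_right (isClosed_posSemidef.preimage hcont)
  have hmem : ∀ r ∈ signallingSet Λ, r ≤ R → r ∈ Prod.fst '' S := by
    rintro r hr hrR
    have h0 := signallingSet_bddBelow hA hΛ hr
    obtain ⟨_, ⟨σ, hσ, rfl⟩, h⟩ := hr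
    exact ⟨(r, σ), ⟨⟨⟨h0, hrR⟩, hσ⟩, mapLE_smul_replaceMap_iff.mp h⟩, rfl⟩
  obtain ⟨r₀, ⟨⟨r₀, σ⟩, ⟨⟨⟨-, hr₀⟩, hσ⟩, h⟩, rfl⟩, hmin⟩ :=
    (hS.image continuous_fst).exists_isLeast ⟨R, hmem R hR le_rfl⟩
  have hleast : IsLeast (signallingSet Λ) r₀ := by
    refine ⟨⟨_, ⟨σ, hσ, rfl⟩, mapLE_smul_replaceMap_iff.mpr h⟩, fun r hr => ?_⟩
    rcases le_total r R with h' | h'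
    · exact hmin (hmem r hr h')
    · exact le_trans hr₀ h'
  rwa [signalling, hleast.csInf_eq]

/-- The robustness of athermality of a channel is that of its output on the thermal input: if `Λ(γA)
≤ (1 + r) γB`, adding to `Λ` the trace-and-replace map of the difference gives `1 + r` times a
Gibbs-preserving channel. -/
theorem mem_athermalitySet_iff [Fintype n] [Fintype m] {γA : Matrix n n ℂ} {γB : Matrix m m ℂ}
    {Λ : Matrix n n ℂ →ₗ[ℂ] Matrix m m ℂ} (hA : IsState γA) (hB : γB.trace = 1)
    (hΛ : IsChannel Λ) {r : ℝ} :
    r ∈ athermalitySet γA γB Λ ↔ OpLE (Λ γA) ((1 + r) • γB) := by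
  constructor
  · rintro ⟨F, ⟨-, hF⟩, h⟩
    have := h.opLE_apply hA.1
    rwa [LinearMap.smul_apply, hF] at this
  · intro h
    have htr : (Λ γA).trace = 1 := (hΛ.2 _).trans hA.2
    have hr : 0 < 1 + r := by linarith [OpLE.nonneg_of_trace h htr hB]
    have e : (1 + r) • ((1 + r)⁻¹ • (Λ + replaceMap n ((1 + r) • γB - Λ γA)))
        = Λ + replaceMap n ((1 + r) • γB - Λ γA) := smul_inv_smul₀ hr.ne' _
    refine ⟨(1 + r)⁻¹ • (Λ + replaceMap n ((1 + r) • γB - Λ γA)), ⟨⟨?_, fun X => ?_⟩, ?_⟩, ?_⟩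
    · exact (hΛ.1.add (isCP_replaceMap h)).smul (inv_nonneg.mpr hr.le)
    · simp only [LinearMap.smul_apply, LinearMap.add_apply, replaceMap_apply, trace_smul,
        trace_add, trace_sub, hΛ.2 X, htr, hB, smul_eq_mul, Complex.real_smul]
      have : ((1 + r : ℝ) : ℂ) ≠ 0 := by exact_mod_cast hr.ne'
      push_cast at this ⊢
      field_simp
      ring
    · rw [LinearMap.smul_apply, LinearMap.add_apply, replaceMap_apply, hA.2, one_smul,
        add_sub_cancel, inv_smul_smul₀ hr.ne']
    · rw [MapLE, e, add_sub_cancel_left]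
      exact isCP_replaceMap h

theorem jointSet_subset_signallingSet [Fintype n] [Fintype m] {γB : Matrix m m ℂ}
    (hB : IsState γB) (Λ : Matrix n n ℂ →ₗ[ℂ] Matrix m m ℂ) :
    jointSet γB Λ ⊆ signallingSet Λ := fun _ hr => ⟨_, ⟨γB, hB, rfl⟩, hr⟩

theorem jointSet_subset_athermalitySet [Fintype n] [Fintype m] {γA : Matrix n n ℂ}
    {γB : Matrix m m ℂ} (hA : IsState γA) (hB : IsState γB)
    (Λ : Matrix n n ℂ →ₗ[ℂ] Matrix m m ℂ) :
    jointSet γB Λ ⊆ athermalitySet γA γB Λ := fun _ hr =>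
  ⟨_, ⟨isChannel_replaceMap hB, by rw [replaceMap_apply, hA.2, one_smul]⟩, hr⟩

/-- From `Λ ≤ (1 + r) Tr(·) σ`, the operator `(1 + r) σ` exceeds `Λ(γA)` by a positive semidefinite
matrix of trace `r`, which is at most `r • 1 ≤ (r / c) γB`; and `Λ(γA) ≤ (1 + u) γB`. Hence
`(1 + r) σ` is dominated by a multiple of `γB`. -/
theorem mem_jointSet_of_signalling_of_athermality [Fintype n] [Fintype m] [DecidableEq m]
    {γA : Matrix n n ℂ}
    {γB : Matrix m m ℂ} {Λ : Matrix n n ℂ →ₗ[ℂ] Matrix m m ℂ} (hA : IsState γA)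
    (hB : γB.trace = 1) (hΛ : IsChannel Λ) {c r u : ℝ} (hc : 0 < c)
    (hcB : OpLE (c • (1 : Matrix m m ℂ)) γB)
    (hr : r ∈ signallingSet Λ) (hu : u ∈ athermalitySet γA γB Λ) :
    u + r / c ∈ jointSet γB Λ := by
  have hr0 := signallingSet_bddBelow hA hΛ.2 hr
  have htr : (Λ γA).trace = 1 := (hΛ.2 _).trans hA.2
  rw [mem_athermalitySet_iff hA hB hΛ] at hu
  obtain ⟨_, ⟨σ, hσ, rfl⟩, h⟩ := hr
  refine MapLE.trans h ?_
  rw [← replaceMap_smul, ← replaceMap_smul]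
  refine mapLE_replaceMap ?_
  have h1 : OpLE (Λ γA) ((1 + r) • σ) := by
    have := h.opLE_apply hA.1
    rwa [LinearMap.smul_apply, replaceMap_apply, hA.2, one_smul] at this
  have h2 : ((1 + r) • σ - Λ γA).trace = r := by
    rw [trace_sub, trace_smul, hσ.2, htr, Complex.real_smul]
    push_cast
    ring
  have h3 := posSemidef_smul_one_sub h1 h2
  have h4 := posSemidef_real_smul hcB (div_nonneg hr0 hc.le)
  have h5 := (h3.add h4).add hu
  have e : r • (1 : Matrix m m ℂ) - ((1 + r) • σ - Λ γA) + (r / c) • (γB - c • (1 : Matrix m m ℂ))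
      + ((1 + u) • γB - Λ γA) = (1 + (u + r / c)) • γB - (1 + r) • σ := by
    rw [smul_sub, smul_smul, div_mul_cancel₀ _ hc.ne', ← add_assoc, add_smul (1 + u)]
    abel
  rwa [e] at h5

end Attained

/-! ### The output of the quantum switch -/

section Switch

variable {ι : Type*}

/-- The map multiplying the coherences of the control in the output of the switch,
`X ↦ ∑ᵢⱼ Kⱼ Kᵢ X Kⱼ† Kᵢ†`. -/
def crossTerm [Fintype n] [Fintype ι] (K : ι → Matrix n n ℂ) (X : Matrix n n ℂ) : Matrix n n ℂ :=
  ∑ i, ∑ j, K j * (K i * X) * (K j)ᴴ * (K i)ᴴ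

theorem single_one_mul_mul_single_one (ρ : Matrix (Fin 2) (Fin 2) ℂ) (a b : Fin 2) :
    Matrix.single a a 1 * ρ * Matrix.single b b 1 = Matrix.single a b (ρ a b) := by
  simp

theorem switchKraus_conj [Fintype n] (K : ι → Matrix n n ℂ) (ρ : Matrix (Fin 2) (Fin 2) ℂ)
    (X : Matrix n n ℂ) (i j : ι) :
    switchKraus K i j * (ρ ⊗ₖ X) * (switchKraus K i j)ᴴ =
      Matrix.single 0 0 (ρ 0 0) ⊗ₖ (K j * K i * X * (K j * K i)ᴴ) +
      Matrix.single 0 1 (ρ 0 1) ⊗ₖ (K j * K i * X * (K i * K j)ᴴ) +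
      (Matrix.single 1 0 (ρ 1 0) ⊗ₖ (K i * K j * X * (K j * K i)ᴴ) +
      Matrix.single 1 1 (ρ 1 1) ⊗ₖ (K i * K j * X * (K i * K j)ᴴ)) := by
  simp only [← single_one_mul_mul_single_one, mul_kronecker_mul, switchKraus, conjTranspose_add,
    conjTranspose_kronecker, conjTranspose_single, star_one, Matrix.add_mul, Matrix.mul_add]
  abel

theorem kronecker_sum {κ : Type*} (S : Finset κ) (A : Matrix m m ℂ) (B : κ → Matrix n n ℂ) :
    A ⊗ₖ (∑ i ∈ S, B i) = ∑ i ∈ S, A ⊗ₖ B i :=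
  map_sum (tensorLeft A) B S

variable [Fintype n] [Fintype ι]

theorem sum_kraus_comp {K : ι → Matrix n n ℂ} {Ω : Matrix n n ℂ →ₗ[ℂ] Matrix n n ℂ}
    (hK : IsKraus K Ω) (X : Matrix n n ℂ) :
    ∑ i, ∑ j, K j * K i * X * (K j * K i)ᴴ = Ω (Ω X) := by
  rw [hK X, map_sum]
  refine Finset.sum_congr rfl fun i _ => ?_
  rw [hK]
  refine Finset.sum_congr rfl fun j _ => ?_
  simp only [conjTranspose_mul, Matrix.mul_assoc]

/-- The populations of the control see `Ω ∘ Ω`, the coherences the cross term. -/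
theorem inducedChannel_apply {K : ι → Matrix n n ℂ} {Ω : Matrix n n ℂ →ₗ[ℂ] Matrix n n ℂ}
    (hK : IsKraus K Ω) (ρ : Matrix (Fin 2) (Fin 2) ℂ) (X : Matrix n n ℂ) :
    inducedChannel K ρ X = !![ρ 0 0, 0; 0, ρ 1 1] ⊗ₖ Ω (Ω X) +
      !![0, ρ 0 1; ρ 1 0, 0] ⊗ₖ crossTerm K X := by
  have h0 : inducedChannel K ρ X
    = ∑ i, ∑ j, switchKraus K i j * (ρ ⊗ₖ X) * (switchKraus K i j)ᴴ := rfl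
  have e1 : !![ρ 0 0, 0; 0, ρ 1 1] = Matrix.single 0 0 (ρ 0 0) + Matrix.single 1 1 (ρ 1 1) := by
    ext a b; fin_cases a <;> fin_cases b <;> simp
  have e2 : !![0, ρ 0 1; ρ 1 0, 0] = Matrix.single 0 1 (ρ 0 1) + Matrix.single 1 0 (ρ 1 0) := by
    ext a b; fin_cases a <;> fin_cases b <;> simp
  have h2 : ∑ i, ∑ j, K i * K j * X * (K i * K j)ᴴ = Ω (Ω X) := by
    rw [Finset.sum_comm]
    exact sum_kraus_comp hK X
  have h3 : ∑ i, ∑ j, K j * K i * X * (K i * K j)ᴴ = crossTerm K X := by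
    simp only [crossTerm, conjTranspose_mul, Matrix.mul_assoc]
  have h4 : ∑ i, ∑ j, K i * K j * X * (K j * K i)ᴴ = crossTerm K X := by
    rw [Finset.sum_comm]
    exact h3
  rw [h0]
  simp only [switchKraus_conj, Finset.sum_add_distrib, ← kronecker_sum]
  rw [sum_kraus_comp hK, h2, h3, h4, e1, e2, add_kronecker, add_kronecker]
  abel

theorem isCP_inducedChannel (K : ι → Matrix n n ℂ) {ρ : Matrix (Fin 2) (Fin 2) ℂ}
    (hρ : ρ.PosSemidef) : IsCP (inducedChannel K ρ) := by
  have : inducedChannel K ρ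
      = ∑ i, ∑ j, conjBy (switchKraus K i j) ∘ₗ tensorLeft ρ := by
    refine LinearMap.ext fun X => ?_
    simp [inducedChannel]
  rw [this]
  exact IsCP.sum _ fun i _ => IsCP.sum _ fun j _ => (isCP_conjBy _).comp (isCP_tensorLeft hρ)

theorem inducedChannel_add (K : ι → Matrix n n ℂ) (ρ τ : Matrix (Fin 2) (Fin 2) ℂ) :
    inducedChannel K (ρ + τ) = inducedChannel K ρ + inducedChannel K τ := by
  refine LinearMap.ext fun X => ?_
  simp only [inducedChannel, LinearMap.add_apply, LinearMap.coe_mk, AddHom.coe_mk, add_kronecker,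
    Matrix.mul_add, Matrix.add_mul, Finset.sum_add_distrib]

theorem isChannel_inducedChannel {K : ι → Matrix n n ℂ} {Ω : Matrix n n ℂ →ₗ[ℂ] Matrix n n ℂ}
    (hK : IsKraus K Ω) (hΩ : ∀ X, (Ω X).trace = X.trace) {ρ : Matrix (Fin 2) (Fin 2) ℂ}
    (hρ : IsState ρ) : IsChannel (inducedChannel K ρ) := by
  refine ⟨isCP_inducedChannel K hρ.1, fun X => ?_⟩
  have h := hρ.2
  rw [trace_fin_two] at h
  rw [inducedChannel_apply hK, trace_add, trace_kronecker, trace_kronecker, hΩ, hΩ]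
  simp [trace_fin_two, h]

/-- Without coherence in the control the two causal orders give the same output. -/
theorem inducedChannel_one {K : ι → Matrix n n ℂ} {Ω : Matrix n n ℂ →ₗ[ℂ] Matrix n n ℂ}
    (hK : IsKraus K Ω) :
    inducedChannel K 1 = tensorLeft (1 : Matrix (Fin 2) (Fin 2) ℂ) ∘ₗ (Ω ∘ₗ Ω) := by
  refine LinearMap.ext fun X => ?_
  have e1 : !![(1 : ℂ), 0; 0, 1] = 1 := Matrix.one_fin_two.symm
  have e2 : !![(0 : ℂ), 0; 0, 0] = 0 := by
    ext a b; fin_cases a <;> fin_cases b <;> rfl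
  rw [inducedChannel_apply hK]
  simp [e1, e2]

end Switch

/-! ### The switch of two partially thermalising channels -/

section PartialThermal

variable [Fintype n] {γ : Matrix n n ℂ} {s : ℝ} {ι : Type*} [Fintype ι] {K : ι → Matrix n n ℂ}

theorem partialThermal_apply (γ : Matrix n n ℂ) (s : ℝ) (X : Matrix n n ℂ) :
    partialThermal γ s X = s • (X.trace • γ) + (1 - s) • X := rfl

theorem trace_partialThermal (hγ_tr : γ.trace = 1) (X : Matrix n n ℂ) :
    (partialThermal γ s X).trace = X.trace := by
  rw [partialThermal_apply, trace_add, trace_smul, trace_smul, trace_smul, hγ_tr, smul_eq_mul,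
    mul_one, ← add_smul, add_sub_cancel, one_smul]

theorem partialThermal_comp_self (hγ_tr : γ.trace = 1) :
    partialThermal γ s ∘ₗ partialThermal γ s
      = (1 - (1 - s) ^ 2) • replaceMap n γ + ((1 - s) ^ 2) • LinearMap.id := by
  refine LinearMap.ext fun X => ?_
  rw [LinearMap.comp_apply, partialThermal_apply, trace_partialThermal hγ_tr, partialThermal_apply]
  simp only [LinearMap.add_apply, LinearMap.smul_apply, replaceMap_apply, LinearMap.id_apply]
  module

/-- The coefficients of a Kraus family that enter the cross term depend only on the channel. -/
theorem sum_trace_mul_smul_conjTranspose (hK : IsKraus K (partialThermal γ s)) (X : Matrix n n ℂ) :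
    haveI := Classical.decEq n
    ∑ i, (K i * X).trace • (K i)ᴴ = s • (X * γ) + (1 - s) • (X.trace • (1 : Matrix n n ℂ)) := by
  classical
  have key : ∀ a b c d, ∑ i, K i a b * star (K i c d)
      = s * ((if b = d then 1 else 0) * γ a c) +
        (1 - s) * ((if b = a then 1 else 0) * (if d = c then 1 else 0)) := by
    intro a b c d
    have h := congrFun (congrFun (hK (Matrix.single b d 1)) a) c
    rw [partialThermal_apply, Matrix.sum_apply] at h
    have h1 : ∀ i, (K i * Matrix.single b d (1 : ℂ) * (K i)ᴴ) a c = K i a b * star (K i c d) := by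
      intro i
      simp [Matrix.single_apply, Matrix.mul_apply, ite_and]
    rw [Finset.sum_congr rfl fun i _ => (h1 i).symm, ← h]
    clear h h1
    by_cases hbd : b = d
    · subst hbd
      simp only [Matrix.add_apply, Matrix.smul_apply, Complex.real_smul, Matrix.single_apply]
      split_ifs <;> simp_all
    · simp only [Matrix.add_apply, Matrix.smul_apply, Complex.real_smul, Matrix.single_apply,
        Matrix.trace_single_eq_of_ne _ _ _ hbd, hbd]
      split_ifs <;> simp_all
  ext d c
  have lhs : (∑ i, (K i * X).trace • (K i)ᴴ) d c
      = ∑ a, ∑ b, X b a * ∑ i, K i a b * star (K i c d) := by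
    simp only [Matrix.sum_apply, Matrix.smul_apply, Matrix.trace, diag_apply, Matrix.mul_apply,
      smul_eq_mul, conjTranspose_apply, Finset.mul_sum, Finset.sum_mul]
    rw [Finset.sum_comm]
    refine Finset.sum_congr rfl fun a _ => ?_
    rw [Finset.sum_comm]
    refine Finset.sum_congr rfl fun b _ => Finset.sum_congr rfl fun i _ => by ring
  rw [lhs]
  simp only [key, mul_add, Finset.sum_add_distrib]
  congr 1
  · simp only [Matrix.smul_apply, Matrix.mul_apply, Complex.real_smul, Finset.mul_sum]
    refine Finset.sum_congr rfl fun a _ => ?_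
    rw [Finset.sum_eq_single d (by intro b _ hb; simp [hb]) (by simp)]
    simp [mul_left_comm]
  · simp only [Matrix.smul_apply, Complex.real_smul, Matrix.trace, diag_apply, smul_eq_mul,
      Matrix.one_apply, Finset.sum_mul, Finset.mul_sum]
    refine Finset.sum_congr rfl fun a _ => ?_
    rw [Finset.sum_eq_single a (by intro b _ hb; simp [hb]) (by simp)]
    push_cast
    simp [mul_comm]

/-- The coherences are damped by a mixture of thermalisation, the identity and `X ↦ γ X γ`; only
the last term remains when both channels thermalise completely. -/
theorem crossTerm_partialThermal (hK : IsKraus K (partialThermal γ s)) (X : Matrix n n ℂ) :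
    crossTerm K X = (2 * s * (1 - s)) • (X.trace • γ) + ((1 - s) ^ 2) • X
      + (s ^ 2) • (γ * X * γ) := by
  classical
  have h1 : ∀ i, ∑ j, K j * (K i * X) * (K j)ᴴ * (K i)ᴴ
      = s • (γ * ((K i * X).trace • (K i)ᴴ)) + (1 - s) • (K i * X * (K i)ᴴ) := by
    intro i
    rw [← Finset.sum_mul, ← hK, partialThermal_apply, Matrix.add_mul]
    simp only [smul_mul_assoc, mul_smul_comm]
  have h2 := sum_trace_mul_smul_conjTranspose hK X
  rw [crossTerm, Finset.sum_congr rfl fun i _ => h1 i, Finset.sum_add_distrib, ← Finset.smul_sum,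
    ← Finset.smul_sum, ← Finset.mul_sum, ← hK, h2, partialThermal_apply]
  simp only [Matrix.mul_add, mul_smul_comm, Matrix.mul_one, Matrix.mul_assoc]
  module

end PartialThermal

/-! ### The control qubit -/

section Control

theorem normSq_controlKet_zero {α : ℝ} (hα : 0 ≤ α) (φ : ℝ) :
    controlKet α φ 0 * star (controlKet α φ 0) = α := by
  simp only [controlKet, cons_val_zero, RCLike.star_def, Complex.conj_ofReal]
  exact_mod_cast Real.mul_self_sqrt hα

theorem normSq_controlKet_one {α : ℝ} (hα : α ≤ 1) (φ : ℝ) :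
    controlKet α φ 1 * star (controlKet α φ 1) = 1 - α := by
  have h1 : (√(1 - α) : ℂ) * (√(1 - α) : ℂ) = ((1 - α : ℝ) : ℂ) := by
    exact_mod_cast Real.mul_self_sqrt (sub_nonneg.mpr hα)
  have h2 : Complex.exp (Complex.I * φ) * Complex.exp (-(Complex.I * φ)) = 1 := by
    rw [← Complex.exp_add, add_neg_cancel, Complex.exp_zero]
  simp only [controlKet, cons_val_one, RCLike.star_def, map_mul, Complex.conj_ofReal,
    ← Complex.exp_conj, Complex.conj_I, neg_mul, cons_val_fin_one]
  calc _ = (Complex.exp (Complex.I * φ) * Complex.exp (-(Complex.I * φ))) *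
        ((√(1 - α) : ℂ) * (√(1 - α) : ℂ)) := by ring
    _ = _ := by rw [h1, h2]; push_cast; ring

theorem controlState_apply (α φ : ℝ) (a b : Fin 2) :
    controlState α φ a b = controlKet α φ a * star (controlKet α φ b) := rfl

theorem isState_controlState {α : ℝ} (hα : α ∈ Set.Icc (0 : ℝ) 1) (φ : ℝ) :
    IsState (controlState α φ) := by
  refine ⟨posSemidef_vecMulVec_self_star _, ?_⟩
  rw [trace_fin_two, controlState_apply, controlState_apply, normSq_controlKet_zero hα.1,
    normSq_controlKet_one hα.2, add_sub_cancel]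

theorem isState_controlThermal : IsState controlThermal := by
  refine ⟨?_, ?_⟩
  · have := posSemidef_real_smul (PosSemidef.one (n := Fin 2) (R := ℂ)) (c := 1 / 2) (by norm_num)
    convert this using 1
    ext a b
    simp [controlThermal]
  · simp [controlThermal]

theorem isState_kronecker [Fintype n] [Fintype m] {ρ : Matrix n n ℂ} {σ : Matrix m m ℂ}
    (hρ : IsState ρ) (hσ : IsState σ) : IsState (ρ ⊗ₖ σ) :=
  ⟨hρ.1.kronecker hσ.1, by rw [trace_kronecker, hρ.2, hσ.2, mul_one]⟩

theorem expectation_diagonal_controlState {α : ℝ} (hα : α ∈ Set.Icc (0 : ℝ) 1) (φ : ℝ) :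
    star (controlKet α φ) ⬝ᵥ
      (!![controlState α φ 0 0, 0; 0, controlState α φ 1 1] *ᵥ controlKet α φ) =
      ((α ^ 2 + (1 - α) ^ 2 : ℝ) : ℂ) := by
  have h0 := normSq_controlKet_zero hα.1 φ
  have h1 := normSq_controlKet_one hα.2 φ
  simp only [controlState_apply]
  simp only [dotProduct, mulVec, Fin.sum_univ_two, Pi.star_apply, of_apply, cons_val_zero,
    cons_val_one, cons_val_fin_one, h0, h1]
  push_cast
  linear_combination (α : ℂ) * h0 + (1 - α : ℂ) * h1

theorem expectation_offDiagonal_controlState {α : ℝ} (hα : α ∈ Set.Icc (0 : ℝ) 1) (φ : ℝ) :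
    star (controlKet α φ) ⬝ᵥ
      (!![0, controlState α φ 0 1; controlState α φ 1 0, 0] *ᵥ controlKet α φ) =
      ((2 * α * (1 - α) : ℝ) : ℂ) := by
  have h0 := normSq_controlKet_zero hα.1 φ
  have h1 := normSq_controlKet_one hα.2 φ
  simp only [controlState_apply]
  simp only [dotProduct, mulVec, Fin.sum_univ_two, Pi.star_apply, of_apply, cons_val_zero,
    cons_val_one, cons_val_fin_one]
  push_cast
  linear_combination (2 * controlKet α φ 1 * star (controlKet α φ 1)) * h0 + (2 * α : ℂ) * h1

theorem expectation_one_controlKet {α : ℝ} (hα : α ∈ Set.Icc (0 : ℝ) 1) (φ : ℝ) :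
    star (controlKet α φ) ⬝ᵥ controlKet α φ = 1 := by
  have h0 := normSq_controlKet_zero hα.1 φ
  have h1 := normSq_controlKet_one hα.2 φ
  simp only [dotProduct, Fin.sum_univ_two, Pi.star_apply]
  linear_combination h0 + h1

theorem controlState_mulVec {α : ℝ} (hα : α ∈ Set.Icc (0 : ℝ) 1) (φ : ℝ) :
    controlState α φ *ᵥ controlKet α φ = controlKet α φ := by
  rw [controlState, vecMulVec_mulVec, expectation_one_controlKet hα]
  simp

theorem posSemidef_one_sub_controlState {α : ℝ} (hα : α ∈ Set.Icc (0 : ℝ) 1) (φ : ℝ) :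
    (1 - controlState α φ).PosSemidef := by
  have h := isState_controlState hα φ
  have := posSemidef_smul_one_sub h.1 (c := 1) (by rw [h.2]; simp)
  rwa [one_smul] at this

theorem smul_controlThermal (c : ℝ) :
    c • controlThermal = (c / 2) • (1 : Matrix (Fin 2) (Fin 2) ℂ) := by
  ext a b
  simp [controlThermal]
  ring

theorem mem_stateAthermalitySet_controlState_iff {α : ℝ} (hα : α ∈ Set.Icc (0 : ℝ) 1) (φ : ℝ)
    {r : ℝ} : r ∈ stateAthermalitySet controlThermal (controlState α φ) ↔ 1 ≤ r := by
  constructor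
  · intro h
    have h1 := PosSemidef.dotProduct_mulVec_nonneg h (controlKet α φ)
    rw [smul_controlThermal, sub_mulVec, controlState_mulVec hα, smul_mulVec, one_mulVec,
      dotProduct_sub, dotProduct_smul, expectation_one_controlKet hα, Complex.real_smul, mul_one,
      show (1 : ℂ) = ((1 : ℝ) : ℂ) by simp, ← Complex.ofReal_sub] at h1
    have h2 : 0 ≤ (1 + r) / 2 - 1 := by exact_mod_cast h1
    linarith
  · intro h
    have h1 := (posSemidef_one_sub_controlState hα φ).add
      (posSemidef_real_smul (PosSemidef.one (n := Fin 2) (R := ℂ)) (c := (r - 1) / 2)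
        (by linarith))
    change PosSemidef _
    rw [smul_controlThermal]
    convert h1 using 1
    module

/-- Contraction of the first tensor factor with the vector `ψ`, the operator `⟨ψ| ⊗ 𝟙`. -/
def contractLeft (n : Type*) [DecidableEq n] (ψ : k → ℂ) : Matrix n (k × n) ℂ :=
  Matrix.of fun i p => star (ψ p.1) * (1 : Matrix n n ℂ) i p.2

theorem conjBy_contractLeft [Fintype k] [Fintype n] [DecidableEq n] (ψ : k → ℂ)
    (A : Matrix k k ℂ) (X : Matrix n n ℂ) :
    conjBy (contractLeft n ψ) (A ⊗ₖ X) = (star ψ ⬝ᵥ (A *ᵥ ψ)) • X := by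
  ext i j
  simp only [conjBy_apply, contractLeft, Matrix.mul_apply, of_apply, kronecker_apply,
    conjTranspose_apply, Fintype.sum_prod_type, star_mul', star_star, Matrix.one_apply,
    Matrix.smul_apply, smul_eq_mul, dotProduct, mulVec, Pi.star_apply]
  simp only [mul_ite, ite_mul, mul_one, mul_zero, zero_mul, Finset.sum_ite_eq, Finset.mem_univ,
    if_true, apply_ite star, star_one, star_zero]
  simp only [Finset.mul_sum, Finset.sum_mul]
  rw [Finset.sum_comm]
  exact Finset.sum_congr rfl fun a _ => Finset.sum_congr rfl fun b _ => by ring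

end Control

/-! ### Robustness of athermality of the switch -/

section Athermality

theorem posSemidef_fin_two_iff {A : Matrix (Fin 2) (Fin 2) ℂ} (hA : A.IsHermitian) {t d : ℝ}
    (ht : A.trace = t) (hd : A.det = d) : A.PosSemidef ↔ 0 ≤ t ∧ 0 ≤ d := by
  constructor
  · intro h
    have h1 := h.trace_nonneg
    have h2 := h.det_nonneg
    rw [ht] at h1
    rw [hd] at h2
    exact ⟨by exact_mod_cast h1, by exact_mod_cast h2⟩
  · rintro ⟨h1, h2⟩
    rw [trace_re_eq_sum_eigenvalues hA] at ht
    rw [hA.det_eq_prod_eigenvalues] at hd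
    rw [Fin.sum_univ_two] at ht
    rw [Fin.prod_univ_two] at hd
    have ht' : hA.eigenvalues 0 + hA.eigenvalues 1 = t := by exact_mod_cast ht
    have hd' : hA.eigenvalues 0 * hA.eigenvalues 1 = d := by
      refine Complex.ofReal_injective ?_
      rw [Complex.ofReal_mul]
      exact hd
    rw [hA.posSemidef_iff_eigenvalues_nonneg]
    intro i
    rw [← ht'] at h1
    rw [← hd'] at h2
    fin_cases i
    · change 0 ≤ hA.eigenvalues 0
      by_contra! h
      have h3 : 0 < hA.eigenvalues 1 := by linarith
      nlinarith
    · change 0 ≤ hA.eigenvalues 1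
      by_contra! h
      have h3 : 0 < hA.eigenvalues 0 := by linarith
      nlinarith

/-- The block of `(1 + r) (γ_C ⊗ γ) - Λ(γ)` at an eigenvector of `γ`, divided by the eigenvalue;
`e` is the factor by which the switch shrinks the coherence of the control there. -/
def controlBlock (α φ r e : ℝ) : Matrix (Fin 2) (Fin 2) ℂ :=
  ((1 + r) / 2) • (1 : Matrix (Fin 2) (Fin 2) ℂ) -
    !![controlState α φ 0 0, 0; 0, controlState α φ 1 1] -
    e • !![0, controlState α φ 0 1; controlState α φ 1 0, 0]

theorem controlBlock_posSemidef_iff {α : ℝ} (hα : α ∈ Set.Icc (0 : ℝ) 1) (φ r e : ℝ) :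
    (controlBlock α φ r e).PosSemidef ↔ √(1 - 4 * (1 - e ^ 2) * (α * (1 - α))) ≤ r := by
  have h0 := normSq_controlKet_zero hα.1 φ
  have h1 := normSq_controlKet_one hα.2 φ
  have hH : (controlBlock α φ r e).IsHermitian := by
    ext a b
    fin_cases a <;> fin_cases b <;> simp [controlBlock, controlState_apply, mul_comm]
  have ht : (controlBlock α φ r e).trace = (r : ℂ) := by
    simp only [controlBlock, trace_fin_two, Matrix.sub_apply, Matrix.smul_apply, of_apply,
      cons_val_zero, cons_val_one, cons_val_fin_one, controlState_apply, h0, h1, Matrix.one_apply,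
      Complex.real_smul]
    push_cast
    simp
    ring
  have hd : (controlBlock α φ r e).det
      = (((r ^ 2 - (1 - 4 * (1 - e ^ 2) * (α * (1 - α)))) / 4 : ℝ) : ℂ) := by
    simp only [controlBlock, det_fin_two, Matrix.sub_apply, Matrix.smul_apply, of_apply,
      cons_val_zero, cons_val_one, cons_val_fin_one, controlState_apply, h0, h1, Matrix.one_apply,
      Complex.real_smul]
    push_cast
    linear_combination (-(e : ℂ) ^ 2 * (controlKet α φ 1 * star (controlKet α φ 1))) * h0 -
      (e : ℂ) ^ 2 * α * h1
  rw [posSemidef_fin_two_iff hH ht hd, Real.sqrt_le_iff]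
  constructor <;> rintro ⟨h2, h3⟩ <;> exact ⟨h2, by linarith⟩

variable [Fintype n] [DecidableEq n] {γ : Matrix n n ℂ} {s α φ : ℝ} {ι : Type*} [Fintype ι]
  {K : ι → Matrix n n ℂ}

/-- A block operator whose blocks are simultaneously diagonal, with `g > 0` scaling each block, is
positive semidefinite exactly when the two-by-two matrix at each eigenvector is. -/
theorem posSemidef_kronecker_sub_iff {U : Matrix n n ℂ} (hU : Uᴴ * U = 1) {g e : n → ℝ}
    (hg : ∀ i, 0 < g i) (P O : Matrix (Fin 2) (Fin 2) ℂ) :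
    (P ⊗ₖ (U * diagonal (fun i => (g i : ℂ)) * Uᴴ) -
      O ⊗ₖ (U * diagonal (fun i => ((g i * e i : ℝ) : ℂ)) * Uᴴ)).PosSemidef ↔
      ∀ i, (P - e i • O).PosSemidef := by
  let N := P ⊗ₖ diagonal (fun i => (g i : ℂ)) - O ⊗ₖ diagonal (fun i => ((g i * e i : ℝ) : ℂ))
  let W := (1 : Matrix (Fin 2) (Fin 2) ℂ) ⊗ₖ U
  have hW : Wᴴ * W = 1 := by
    rw [conjTranspose_kronecker, ← mul_kronecker_mul, hU]
    simp
  have hN : P ⊗ₖ (U * diagonal (fun i => (g i : ℂ)) * Uᴴ) -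
      O ⊗ₖ (U * diagonal (fun i => ((g i * e i : ℝ) : ℂ)) * Uᴴ) = W * N * Wᴴ := by
    simp only [W, N, Matrix.mul_sub, Matrix.sub_mul, conjTranspose_kronecker, ← mul_kronecker_mul,
      conjTranspose_one, Matrix.one_mul, Matrix.mul_one]
  have hNiff : (W * N * Wᴴ).PosSemidef ↔ N.PosSemidef := by
    refine ⟨fun h => ?_, fun h => h.mul_mul_conjTranspose_same W⟩
    have h1 := h.conjTranspose_mul_mul_same W
    have h2 : Wᴴ * (W * N * Wᴴ) * W = (Wᴴ * W) * N * (Wᴴ * W) := by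
      simp only [Matrix.mul_assoc]
    rwa [h2, hW, Matrix.one_mul, Matrix.mul_one] at h1
  rw [hN, hNiff]
  constructor
  · intro h i
    have h1 := posSemidef_real_smul (h.submatrix fun c : Fin 2 => (c, i)) (inv_pos.mpr (hg i)).le
    convert h1 using 1
    ext a b
    have : (g i : ℂ) ≠ 0 := by exact_mod_cast (hg i).ne'
    simp only [N, Matrix.smul_apply, Matrix.sub_apply, submatrix_apply, kronecker_apply,
      diagonal_apply_eq, Complex.real_smul]
    push_cast
    field_simp
  · intro h
    have h1 : N = ∑ i, (g i • (P - e i • O)) ⊗ₖ Matrix.single i i (1 : ℂ) := by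
      ext ⟨a, i⟩ ⟨b, j⟩
      simp only [N, Matrix.sum_apply, Matrix.sub_apply, kronecker_apply, Matrix.smul_apply,
        Complex.real_smul]
      by_cases hij : i = j
      · subst hij
        rw [Finset.sum_eq_single i (by intro l _ hl; simp [hl]) (by simp)]
        simp
        ring
      · rw [Finset.sum_eq_zero]
        · simp [hij]
        · intro l _
          rw [Matrix.single_apply, if_neg, mul_zero]
          rintro ⟨rfl, rfl⟩
          exact hij rfl
    rw [h1]
    refine posSemidef_sum _ fun i _ => (posSemidef_real_smul (h i) (hg i).le).kronecker ?_
    have h2 : Matrix.single i i (1 : ℂ) = vecMulVec (Pi.single i 1) (star (Pi.single i 1)) := by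
      ext a b
      by_cases h3 : i = a <;> by_cases h4 : i = b <;>
        simp [Matrix.single_apply, vecMulVec_apply, Pi.single_apply, h3, h4, eq_comm]
    rw [h2]
    exact posSemidef_vecMulVec_self_star _

/-- At the eigenvector of population `g` the coherence of the control is multiplied by
`1 - s² (1 - g²)`, as `crossTerm K γ = (1 - s²) γ + s² γ³`. -/
theorem mem_athermalitySet_inducedChannel_iff (hγ : γ.PosDef) (hγ_tr : γ.trace = 1)
    (hα : α ∈ Set.Icc (0 : ℝ) 1) (hK : IsKraus K (partialThermal γ s)) {r : ℝ} :
    r ∈ athermalitySet γ (controlThermal ⊗ₖ γ) (inducedChannel K (controlState α φ)) ↔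
      ∀ i, √(1 - 4 * (1 - (1 - s ^ 2 * (1 - hγ.isHermitian.eigenvalues i ^ 2)) ^ 2) *
        (α * (1 - α))) ≤ r := by
  have hγs : IsState γ := ⟨hγ.posSemidef, hγ_tr⟩
  rw [mem_athermalitySet_iff hγs (isState_kronecker isState_controlThermal hγs).2
    (isChannel_inducedChannel hK (trace_partialThermal hγ_tr) (isState_controlState hα φ))]
  simp only [← controlBlock_posSemidef_iff hα φ]
  obtain ⟨U, hU, hU', hγ'⟩ := exists_unitary_diagonalization hγ.isHermitian
  have hpos := hγ.eigenvalues_pos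
  generalize hγ.isHermitian.eigenvalues = g at *
  have hfix : partialThermal γ s γ = γ := by
    rw [partialThermal_apply, hγ_tr]
    module
  have hcube : γ * γ * γ = U * diagonal (fun i => ((g i ^ 3 : ℝ) : ℂ)) * Uᴴ := by
    have e : diagonal (fun i => ((g i ^ 3 : ℝ) : ℂ)) = diagonal (fun i => (g i : ℂ)) *
        diagonal (fun i => (g i : ℂ)) * diagonal (fun i => (g i : ℂ)) := by
      rw [diagonal_mul_diagonal, diagonal_mul_diagonal]
      congr 1
      ext i
      push_cast
      ring
    calc γ * γ * γ = U * diagonal (fun i => (g i : ℂ)) * (Uᴴ * U) * diagonal (fun i => (g i : ℂ))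
          * (Uᴴ * U) * diagonal (fun i => (g i : ℂ)) * Uᴴ := by
            rw [hγ']; simp only [Matrix.mul_assoc]
      _ = _ := by
            rw [hU', e]
            simp only [Matrix.mul_one, Matrix.mul_assoc]
  have hcross : crossTerm K γ
      = U * diagonal (fun i => ((g i * (1 - s ^ 2 * (1 - g i ^ 2)) : ℝ) : ℂ)) * Uᴴ := by
    have e : diagonal (fun i => ((g i * (1 - s ^ 2 * (1 - g i ^ 2)) : ℝ) : ℂ))
        = (1 - s ^ 2) • diagonal (fun i => (g i : ℂ)) +
          (s ^ 2) • diagonal (fun i => ((g i ^ 3 : ℝ) : ℂ)) := by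
      ext i j
      by_cases hij : i = j
      · subst hij
        simp
        ring
      · simp [hij]
    rw [crossTerm_partialThermal hK, hcube, hγ_tr, e, Matrix.mul_add, Matrix.add_mul,
      mul_smul_comm, smul_mul_assoc, mul_smul_comm, smul_mul_assoc, ← hγ']
    module
  have hdiff : (1 + r) • (controlThermal ⊗ₖ γ) - inducedChannel K (controlState α φ) γ
      = (((1 + r) / 2) • (1 : Matrix (Fin 2) (Fin 2) ℂ) -
          !![controlState α φ 0 0, 0; 0, controlState α φ 1 1]) ⊗ₖ γ -
        !![0, controlState α φ 0 1; controlState α φ 1 0, 0] ⊗ₖ crossTerm K γ := by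
    have e : ∀ A B : Matrix (Fin 2) (Fin 2) ℂ, (A - B) ⊗ₖ γ = A ⊗ₖ γ - B ⊗ₖ γ := fun A B => by
      rw [eq_sub_iff_add_eq, ← add_kronecker, sub_add_cancel]
    rw [inducedChannel_apply hK, hfix, hfix, ← smul_kronecker, smul_controlThermal, e, sub_sub]
  change PosSemidef _ ↔ _
  rw [hdiff, hcross]
  conv_lhs => rw [hγ']
  exact posSemidef_kronecker_sub_iff hU' hpos _ _

end Athermality

/-! ### Joint robustness of the switch -/

section JointBounds

variable [Fintype n] [DecidableEq n] {γ : Matrix n n ℂ} {s α φ q : ℝ} {ι : Type*} [Fintype ι]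
  {K : ι → Matrix n n ℂ}

/-- The control state is dominated by `𝟙`, for which the switch decoheres into `𝟙 ⊗ G ∘ G`. -/
theorem mem_jointSet_inducedChannel (hγ : γ.PosDef) (hγ_tr : γ.trace = 1)
    (hq : γ⁻¹.trace = q) (hα : α ∈ Set.Icc (0 : ℝ) 1) (hK : IsKraus K (partialThermal γ s)) :
    1 + 2 * (1 - s) ^ 2 * (q - 1) ∈
      jointSet (controlThermal ⊗ₖ γ) (inducedChannel K (controlState α φ)) := by
  have h1 : MapLE (inducedChannel K (controlState α φ)) (inducedChannel K 1) := by
    have := isCP_inducedChannel K (posSemidef_one_sub_controlState hα φ)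
    have e := inducedChannel_add K (controlState α φ) (1 - controlState α φ)
    rw [add_sub_cancel] at e
    rwa [MapLE, e, add_sub_cancel_left]
  refine h1.trans ?_
  have h2 := (isCP_smul_replaceMap_sub_smul_id_iff hγ hγ_tr hq (a := (1 - s) ^ 2)
    (t := (1 - s) ^ 2 * q) (sq_nonneg _)).mpr le_rfl
  have h3 := (isCP_tensorLeft (n := n) (PosSemidef.one (n := Fin 2) (R := ℂ))).comp h2
  rw [inducedChannel_one hK, partialThermal_comp_self hγ_tr, MapLE]
  convert h3 using 1
  refine LinearMap.ext fun X => ?_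
  have e : controlThermal ⊗ₖ γ = (1 / 2 : ℝ) • ((1 : Matrix (Fin 2) (Fin 2) ℂ) ⊗ₖ γ) := by
    have := smul_controlThermal 1
    rw [one_smul] at this
    rw [this, smul_kronecker]
  simp only [LinearMap.sub_apply, LinearMap.smul_apply, LinearMap.comp_apply, LinearMap.add_apply,
    replaceMap_apply, LinearMap.id_apply, e, map_sub, map_add, map_smul,
    LinearMap.map_smul_of_tower, tensorLeft_apply]
  module

/-- Contracting the control with its own vector turns a joint bound for the switch into a bound
for a mixture of `G ∘ G` and the cross term. -/
theorem isCP_of_mem_jointSet_inducedChannel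
    (hα : α ∈ Set.Icc (0 : ℝ) 1) (hK : IsKraus K (partialThermal γ s)) {r : ℝ}
    (hr : r ∈ jointSet (controlThermal ⊗ₖ γ) (inducedChannel K (controlState α φ)))
    {Ψ : Matrix n n ℂ →ₗ[ℂ] Matrix n n ℂ}
    (hΨ : ∀ X, Ψ X = (α ^ 2 + (1 - α) ^ 2) • partialThermal γ s (partialThermal γ s X) +
      (2 * α * (1 - α)) • crossTerm K X) :
    IsCP (((1 + r) / 2) • replaceMap n γ - Ψ) := by
  have h := (isCP_conjBy (contractLeft n (controlKet α φ))).comp hr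
  convert h using 1
  refine LinearMap.ext fun X => ?_
  have hΓ : conjBy (contractLeft n (controlKet α φ))
      (((1 + r) • replaceMap n (controlThermal ⊗ₖ γ)) X) = X.trace • ((1 + r) / 2) • γ := by
    rw [← replaceMap_smul, replaceMap_apply, map_smul, ← smul_kronecker, conjBy_contractLeft,
      smul_controlThermal, smul_mulVec, one_mulVec, dotProduct_smul,
      expectation_one_controlKet hα, Complex.real_smul, mul_one, Complex.coe_smul]
  rw [LinearMap.comp_apply, LinearMap.sub_apply, LinearMap.sub_apply, map_sub, hΓ,
    inducedChannel_apply hK, map_add, conjBy_contractLeft, conjBy_contractLeft,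
    expectation_diagonal_controlState hα, expectation_offDiagonal_controlState hα, hΨ,
    LinearMap.smul_apply, replaceMap_apply, smul_comm, Complex.coe_smul, Complex.coe_smul]

/-- The sum `∑_{ab} Φ(|a⟩⟨b|)_{ab}` is the expectation of the Choi matrix in the maximally entangled
vector. -/
theorem IsCP.sum_apply_single_nonneg {Φ : Matrix n n ℂ →ₗ[ℂ] Matrix n n ℂ} (h : IsCP Φ) :
    0 ≤ ∑ a, ∑ b, Φ (Matrix.single a b 1) a b := by
  have h1 := (isCP_iff_posSemidef_choi.mp h).dotProduct_mulVec_nonneg (maxEnt n)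
  convert h1 using 1
  simp [dotProduct, mulVec, maxEnt, Fintype.sum_prod_type, choi, apply_ite]

/-- In the extreme cases the upper bound on the joint robustness is optimal. The contraction with
the control vector leaves a map whose robustness against `Γ` is known, or, when `s = 1`, whose Choi
matrix is tested on the maximally entangled vector. -/
theorem le_of_mem_jointSet_inducedChannel (hγ : γ.PosDef) (hγ_tr : γ.trace = 1)
    (hq : γ⁻¹.trace = q) (hα : α ∈ Set.Icc (0 : ℝ) 1) (hK : IsKraus K (partialThermal γ s))
    (hcase : α = 0 ∨ α = 1 ∨ s = 0 ∨ s = 1) {r : ℝ}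
    (hr : r ∈ jointSet (controlThermal ⊗ₖ γ) (inducedChannel K (controlState α φ))) :
    1 + 2 * (1 - s) ^ 2 * (q - 1) ≤ r := by
  have hGG : ∀ X, partialThermal γ s (partialThermal γ s X)
      = (1 - (1 - s) ^ 2) • (X.trace • γ) + ((1 - s) ^ 2) • X := fun X =>
    LinearMap.congr_fun (partialThermal_comp_self (s := s) hγ_tr) X
  by_cases hs1 : s = 1
  · subst hs1
    -- here the mixture is `X ↦ (α² + (1 - α)²) Tr(X) γ + 2 α (1 - α) γ X γ`
    have hΨ := isCP_of_mem_jointSet_inducedChannel hα hK hr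
      (Ψ := (α ^ 2 + (1 - α) ^ 2) • replaceMap n γ + (2 * α * (1 - α)) • conjBy γ) (fun X => by
        rw [hGG, crossTerm_partialThermal hK]
        simp only [LinearMap.add_apply, LinearMap.smul_apply, replaceMap_apply, conjBy_apply,
          hγ.isHermitian.eq]
        module)
    have h1 := hΨ.sum_apply_single_nonneg
    have e1 : ∑ a, ∑ b, replaceMap n γ (Matrix.single a b 1) a b = 1 := by
      refine Eq.trans ?_ hγ_tr
      refine Finset.sum_congr rfl fun a _ => ?_
      rw [Finset.sum_eq_single a (fun b _ hb => by
        simp [replaceMap_apply, Matrix.trace_single_eq_of_ne _ _ _ hb.symm]) (by simp)]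
      simp [replaceMap_apply]
    have e2 : ∑ a, ∑ b, conjBy γ (Matrix.single a b 1) a b = 1 := by
      have : ∀ a b, conjBy γ (Matrix.single a b 1) a b = γ a a * γ b b := by
        intro a b
        rw [conjBy_apply, hγ.isHermitian.eq]
        simp [Matrix.mul_apply, Matrix.single_apply, ite_and]
      simp only [this, ← Finset.mul_sum, ← Finset.sum_mul]
      change γ.trace * γ.trace = 1
      rw [hγ_tr, mul_one]
    simp only [LinearMap.sub_apply, LinearMap.add_apply, LinearMap.smul_apply, Matrix.sub_apply,
      Matrix.add_apply, Matrix.smul_apply, Finset.sum_sub_distrib, Finset.sum_add_distrib,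
      ← Finset.smul_sum, e1, e2] at h1
    simp only [Complex.real_smul, mul_one] at h1
    have h2 : 0 ≤ (1 + r) / 2 - (α ^ 2 + (1 - α) ^ 2 + 2 * α * (1 - α)) := by exact_mod_cast h1
    nlinarith
  · -- in the other cases the coherences contribute nothing, or the cross term is the identity
    have hΨ := isCP_of_mem_jointSet_inducedChannel hα hK hr
      (Ψ := (1 - (1 - s) ^ 2) • replaceMap n γ + ((1 - s) ^ 2) • LinearMap.id) (fun X => by
        rw [hGG, crossTerm_partialThermal hK]
        simp only [LinearMap.add_apply, LinearMap.smul_apply, replaceMap_apply, LinearMap.id_apply]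
        rcases hcase with rfl | rfl | rfl | h
        · module
        · module
        · module
        · exact absurd h hs1)
    rw [← sub_sub, ← sub_smul ((1 + r) / 2) _ (replaceMap n γ),
      isCP_smul_replaceMap_sub_smul_id_iff hγ hγ_tr hq (sq_nonneg _)] at hΨ
    linarith

end JointBounds

/-! ### Populations of the thermal state and numerical bounds -/

section Populations

variable [Fintype n] [DecidableEq n] {γ : Matrix n n ℂ}

theorem eigenvalues_le_one (hγ : γ.PosDef) (hγ_tr : γ.trace = 1) (i : n) :
    hγ.isHermitian.eigenvalues i ≤ 1 := by
  rw [← eigenvalues_sum_eq_one hγ hγ_tr]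
  exact Finset.single_le_sum (fun j _ => (hγ.eigenvalues_pos j).le) (Finset.mem_univ i)

theorem card_le_sum_inv_eigenvalues (hγ : γ.PosDef) (hγ_tr : γ.trace = 1) :
    (Fintype.card n : ℝ) ≤ ∑ i, (hγ.isHermitian.eigenvalues i)⁻¹ := by
  have : ∑ _i : n, (1 : ℝ) ≤ ∑ i, (hγ.isHermitian.eigenvalues i)⁻¹ :=
    Finset.sum_le_sum fun i _ => (one_le_inv₀ (hγ.eigenvalues_pos i)).mpr
      (eigenvalues_le_one hγ hγ_tr i)
  simpa using this

theorem card_mul_le_one (hγ : γ.PosDef) (hγ_tr : γ.trace = 1) {c : ℝ}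
    (hc : ∀ i, c ≤ hγ.isHermitian.eigenvalues i) : Fintype.card n * c ≤ 1 := by
  rw [← eigenvalues_sum_eq_one hγ hγ_tr]
  have : ∑ _i : n, c ≤ ∑ i, hγ.isHermitian.eigenvalues i := Finset.sum_le_sum fun i _ => hc i
  simpa using this

theorem sum_inv_eigenvalues_mul_sq_le_one (hγ : γ.PosDef) (hγ_tr : γ.trace = 1) {c : ℝ}
    (hc0 : 0 < c) (hc : ∀ i, c ≤ hγ.isHermitian.eigenvalues i) :
    (∑ i, (hγ.isHermitian.eigenvalues i)⁻¹) * c ^ 2 ≤ 1 := by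
  have h1 : ∑ i, (hγ.isHermitian.eigenvalues i)⁻¹ ≤ Fintype.card n * c⁻¹ := by
    have : ∑ i, (hγ.isHermitian.eigenvalues i)⁻¹ ≤ ∑ _i : n, c⁻¹ :=
      Finset.sum_le_sum fun i _ => inv_anti₀ hc0 (hc i)
    simpa using this
  calc _ ≤ Fintype.card n * c⁻¹ * c ^ 2 := by gcongr
    _ = Fintype.card n * c := by field_simp
    _ ≤ 1 := card_mul_le_one hγ hγ_tr hc

theorem eigenvalues_eq_one_of_card_le_one (hγ : γ.PosDef) (hγ_tr : γ.trace = 1)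
    (h : Fintype.card n ≤ 1) (i : n) : hγ.isHermitian.eigenvalues i = 1 := by
  have := Fintype.card_le_one_iff_subsingleton.mp h
  rw [← eigenvalues_sum_eq_one hγ hγ_tr, Fintype.sum_subsingleton _ i]

theorem opLE_smul_one_thermal (hγ : γ.PosDef) {c : ℝ}
    (hc : ∀ i, c ≤ hγ.isHermitian.eigenvalues i) :
    OpLE ((c / 2) • (1 : Matrix (Fin 2 × n) (Fin 2 × n) ℂ)) (controlThermal ⊗ₖ γ) := by
  have h := isState_controlThermal.1.kronecker (posSemidef_sub_smul_one hγ.isHermitian hc)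
  have e : controlThermal ⊗ₖ (γ - c • (1 : Matrix n n ℂ))
      = controlThermal ⊗ₖ γ - (c • controlThermal) ⊗ₖ (1 : Matrix n n ℂ) := by
    rw [eq_sub_iff_add_eq, smul_kronecker, ← kronecker_smul, ← kronecker_add, sub_add_cancel]
  rwa [e, smul_controlThermal, smul_kronecker, one_kronecker_one] at h

/-- The square root in the athermality formula is largest at the largest population. -/
theorem sqrt_athermality_mono {s α x y : ℝ} (hs : s ∈ Set.Icc (0 : ℝ) 1)
    (hα : α ∈ Set.Icc (0 : ℝ) 1) (hx : 0 ≤ x) (hxy : x ≤ y) :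
    √(1 - 4 * (1 - (1 - s ^ 2 * (1 - x ^ 2)) ^ 2) * (α * (1 - α))) ≤
      √(1 - 4 * (1 - (1 - s ^ 2 * (1 - y ^ 2)) ^ 2) * (α * (1 - α))) := by
  apply Real.sqrt_le_sqrt
  have h1 : 0 ≤ α * (1 - α) := mul_nonneg hα.1 (sub_nonneg.mpr hα.2)
  have h2 : s ^ 2 ≤ 1 := pow_le_one₀ hs.1 hs.2
  have h3 : 0 ≤ 1 - s ^ 2 * (1 - x ^ 2) := by nlinarith [mul_nonneg (sq_nonneg s) (sq_nonneg x)]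
  have h4 : 1 - s ^ 2 * (1 - x ^ 2) ≤ 1 - s ^ 2 * (1 - y ^ 2) := by gcongr
  have h5 := pow_le_pow_left₀ h3 h4 2
  nlinarith [mul_le_mul_of_nonneg_right h5 h1]

/-- A linear bound and an absolute bound on `x` combine to the quadratic one; `g ≤ 1 / 2` holds for
the smallest population as soon as the dimension is at least two. -/
theorem pow_four_mul_sq_le {g x r : ℝ} (hg : 0 < g) (hg' : g ≤ 1 / 2) (hr : 0 ≤ r) (hx : 0 ≤ x)
    (h1 : g * x ≤ 2 * r) (h2 : g ^ 2 * x ≤ 2) : g ^ 4 / 2 * x ^ 2 ≤ r := by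
  have h3 : (g * x) * (g ^ 2 * x) ≤ 2 * r * 2 :=
    mul_le_mul h1 h2 (by positivity) (by positivity)
  calc g ^ 4 / 2 * x ^ 2 = g / 2 * ((g * x) * (g ^ 2 * x)) := by ring
    _ ≤ g / 2 * (2 * r * 2) := by gcongr
    _ = g * (2 * r) := by ring
    _ ≤ 1 / 2 * (2 * r) := by gcongr
    _ = r := by ring

end Populations

end QSwitch

end

open QSwitch in
theorem theorem6 {n : Type*} [Fintype n] [DecidableEq n]
    -- the full-rank thermal state of the systems `A` and `B`
    (γ : Matrix n n ℂ) (hγ : γ.PosDef) (hγ_tr : γ.trace = 1)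
    (α s φ : ℝ) (hα : α ∈ Set.Icc (0 : ℝ) 1) (hs : s ∈ Set.Icc (0 : ℝ) 1)
    (hφ : φ ∈ Set.Icc (0 : ℝ) (2 * Real.pi))
    -- an arbitrary Kraus representation of `G = s Γ + (1 - s) id`
    {ι : Type*} [Fintype ι] (K : ι → Matrix n n ℂ) (hK : IsKraus K (partialThermal γ s)) :
    let ρC := controlState α φ
    let G := partialThermal γ s
    let I : Matrix n n ℂ →ₗ[ℂ] Matrix n n ℂ := LinearMap.id
    let Λ := inducedChannel K ρC
    -- the thermal state of the output system
    let γout := controlThermal ⊗ₖ γ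
    let gmin := ⨅ i, hγ.isHermitian.eigenvalues i
    let gmax := ⨆ i, hγ.isHermitian.eigenvalues i
    -- all minima that define the resource measures below are attained
    (IsLeast (jointSet γout Λ) (joint γout Λ) ∧
      IsLeast (athermalitySet γ γout Λ) (athermality γ γout Λ) ∧
      IsLeast (signallingSet Λ) (signalling Λ) ∧
      IsLeast (stateAthermalitySet controlThermal ρC) (stateAthermality controlThermal ρC) ∧
      IsLeast (jointSet γ G) (joint γ G) ∧
      IsLeast (jointSet γ I) (joint γ I)) ∧
    -- the denominator of the upper bound vanishes in dimension one only
    (1 < Fintype.card n → 0 < joint γ I) ∧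
    joint γout Λ ≤ stateAthermality controlThermal ρC + 2 * joint γ G ^ 2 / joint γ I ∧
    stateAthermality controlThermal ρC = 1 ∧
    signalling Λ ≤ joint γout Λ ∧
    gmin ^ 4 / 2 * (joint γout Λ - athermality γ γout Λ) ^ 2 ≤ signalling Λ ∧
    athermality γ γout Λ =
      Real.sqrt (1 - 4 * (1 - gmax ^ 2) * (2 - (1 - gmax ^ 2) * s ^ 2) * s ^ 2 * α * (1 - α)) ∧
    (α = 0 ∨ α = 1 ∨ s = 0 ∨ s = 1 →
      joint γout Λ = stateAthermality controlThermal ρC + 2 * joint γ G ^ 2 / joint γ I) := by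
  intro ρC G I Λ γout gmin gmax
  have hne : Nonempty n := nonempty_of_trace_eq_one hγ_tr
  have hγs : IsState γ := ⟨hγ.posSemidef, hγ_tr⟩
  have hout : IsState γout := isState_kronecker isState_controlThermal hγs
  have hΛ : IsChannel Λ :=
    isChannel_inducedChannel hK (trace_partialThermal hγ_tr) (isState_controlState hα φ)
  have hq := trace_inv_eq_sum hγ
  have hcardq := card_le_sum_inv_eigenvalues hγ hγ_tr
  have hupper := mem_jointSet_inducedChannel (φ := φ) hγ hγ_tr hq hα hK
  have hgmin : ∀ i, gmin ≤ hγ.isHermitian.eigenvalues i := fun i =>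
    ciInf_le (Set.finite_range _).bddBelow i
  obtain ⟨imin, himin⟩ := exists_eq_ciInf_of_finite (f := hγ.isHermitian.eigenvalues)
  have hgmin0 : 0 < gmin := (hγ.eigenvalues_pos imin).trans_eq himin
  have hgmax : ∀ i, hγ.isHermitian.eigenvalues i ≤ gmax := fun i =>
    le_ciSup (Set.finite_range _).bddAbove i
  obtain ⟨imax, himax⟩ := exists_eq_ciSup_of_finite (f := hγ.isHermitian.eigenvalues)
  have hqmin := sum_inv_eigenvalues_mul_sq_le_one hγ hγ_tr hgmin0 hgmin
  have hsumone : Fintype.card n ≤ 1 → ∑ i, (hγ.isHermitian.eigenvalues i)⁻¹ = 1 := fun h => by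
    have := Fintype.card_le_one_iff_subsingleton.mp h
    rw [Fintype.sum_subsingleton _ imax, eigenvalues_eq_one_of_card_le_one hγ hγ_tr h, inv_one]
  generalize hqdef : ∑ i, (hγ.isHermitian.eigenvalues i)⁻¹ = q at *
  have hjoint : IsLeast (jointSet γout Λ) (joint γout Λ) :=
    isLeast_joint hγs hout.2 hΛ.2 ⟨_, hupper⟩
  have hsig : IsLeast (signallingSet Λ) (signalling Λ) :=
    isLeast_signalling hγs hΛ.2 ⟨_, jointSet_subset_signallingSet hout Λ hupper⟩
  have hstate := isLeast_of_forall_mem_iff fun r =>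
    mem_stateAthermalitySet_controlState_iff (r := r) hα φ
  have hjG := isLeast_of_forall_mem_iff fun r =>
    mem_jointSet_partialThermal_iff (r := r) hγ hγ_tr hq hs.2
  have hjI := isLeast_of_forall_mem_iff fun r => mem_jointSet_id_iff (r := r) hγ hγ_tr hq
  have hath : IsLeast (athermalitySet γ γout Λ)
      √(1 - 4 * (1 - gmax ^ 2) * (2 - (1 - gmax ^ 2) * s ^ 2) * s ^ 2 * α * (1 - α)) := by
    refine isLeast_of_forall_mem_iff fun r => ?_
    have e : √(1 - 4 * (1 - gmax ^ 2) * (2 - (1 - gmax ^ 2) * s ^ 2) * s ^ 2 * α * (1 - α))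
        = √(1 - 4 * (1 - (1 - s ^ 2 * (1 - gmax ^ 2)) ^ 2) * (α * (1 - α))) := by
      congr 1
      ring
    rw [mem_athermalitySet_inducedChannel_iff hγ hγ_tr hα hK, e]
    refine ⟨fun h => ?_, fun h i => ?_⟩
    · have := h imax
      rwa [himax] at this
    · exact (sqrt_athermality_mono hs hα (hγ.eigenvalues_pos i).le (hgmax i)).trans h
  have hstate' : stateAthermality controlThermal ρC = 1 := hstate.csInf_eq
  have hjG' : joint γ G = (1 - s) * (q - 1) := hjG.csInf_eq
  have hjI' : joint γ I = q - 1 := hjI.csInf_eq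
  have hath' : athermality γ γout Λ = _ := hath.csInf_eq
  have hbound : stateAthermality controlThermal ρC + 2 * joint γ G ^ 2 / joint γ I
      = 1 + 2 * (1 - s) ^ 2 * (q - 1) := by
    rw [hstate', hjG', hjI']
    rcases eq_or_ne (q - 1) 0 with h | h
    · simp [h]
    · field_simp
  refine ⟨⟨hjoint, ?_, hsig, ?_, ?_, ?_⟩, ?_, ?_, hstate', ?_, ?_, hath', ?_⟩
  · rwa [hath']
  · rwa [hstate']
  · rwa [hjG']
  · rwa [hjI']
  · intro h
    have : (1 : ℝ) < Fintype.card n := by exact_mod_cast h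
    rw [hjI']
    linarith
  · rw [hbound]
    exact hjoint.2 hupper
  · exact hsig.2 (jointSet_subset_signallingSet hout Λ hjoint.1)
  · have hR := hjoint.2 hupper
    have hsig0 := signallingSet_bddBelow hγs hΛ.2 hsig.1
    have hx : 0 ≤ joint γout Λ - athermality γ γout Λ := by
      rw [hath']
      exact sub_nonneg.mpr (hath.2 (jointSet_subset_athermalitySet hγs hout Λ hjoint.1))
    rcases Nat.lt_or_ge 1 (Fintype.card n) with hcard | hcard
    · have hath0 : 0 ≤ athermality γ γout Λ := hath' ▸ Real.sqrt_nonneg _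
      have h1 := hjoint.2 (mem_jointSet_of_signalling_of_athermality hγs hout.2 hΛ
        (half_pos hgmin0) (opLE_smul_one_thermal hγ hgmin) hsig.1 (hath' ▸ hath.1))
      have hcard' : (2 : ℝ) ≤ Fintype.card n := by exact_mod_cast hcard
      have h2 := card_mul_le_one hγ hγ_tr hgmin
      have hs2 : (1 - s) ^ 2 ≤ 1 := pow_le_one₀ (sub_nonneg.mpr hs.2) (by linarith [hs.1])
      have h3 : (1 - s) ^ 2 * (q - 1) ≤ q - 1 := mul_le_of_le_one_left (by linarith) hs2
      refine pow_four_mul_sq_le hgmin0 (by nlinarith) hsig0 hx ?_ ?_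
      · have h4 : joint γout Λ - athermality γ γout Λ ≤ signalling Λ / (gmin / 2) := by linarith
        rw [le_div_iff₀ (half_pos hgmin0)] at h4
        linarith
      · calc gmin ^ 2 * (joint γout Λ - athermality γ γout Λ) ≤ gmin ^ 2 * (2 * q) := by
              gcongr
              linarith
          _ ≤ 2 := by linarith
    · -- in dimension one both robustnesses equal `1`
      have hg1 : gmax = 1 :=
        himax.symm.trans (eigenvalues_eq_one_of_card_le_one hγ hγ_tr hcard imax)
      have ha1 : athermality γ γout Λ = 1 := by
        rw [hath', hg1]
        simp
      rw [hsumone hcard] at hR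
      have h0 : joint γout Λ - athermality γ γout Λ = 0 := le_antisymm (by linarith) hx
      rw [h0]
      simpa using hsig0
  · intro hcase
    rw [hbound]
    exact le_antisymm (hjoint.2 hupper)
      (le_of_mem_jointSet_inducedChannel hγ hγ_tr hq hα hK hcase hjoint.1)
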